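/- Let $d\ge 1$ and $k\ge 0$ be integers, and let $f$ be a complex-valued function on $\mathbb R^d$, smooth on $\mathbb R^d\setminus\{0\}$ and homogeneous of degree $-d-k$, i.e. $f(tx)=t^{-d-k}f(x)$ for all $t>0$, $x\ne0$. For $\mu>0$ put $w_\mu(x)=H(\mu^{-1}-|x|)$, with $H$ the Heaviside step function, and for $\varphi\in\mathcal S(\mathbb R^d)$ $$T_{w_\mu}\varphi(x)=\varphi(x)-\sum_{|\alpha|\le k-1}\frac{x^\alpha}{\alpha!}\,\partial^\alpha\varphi(0)-w_\mu(x)\sum_{|\alpha|=k}\frac{x^\alpha}{\alpha!}\,\partial^\alpha\varphi(0),\qquad \langle T_\mu f,\varphi\rangle=\int_{\mathbb R^d}f(x)\,T_{w_\mu}\varphi(x)\,dx .$$ Write $\delta^\alpha=\frac{(-1)^{|\alpha|}}{\alpha!}\partial^\alpha\delta$, $c^\alpha=\int_{|x|=1}f\,x^\alpha$ (surface measure of the unit sphere), and $H_k=\sum_{l=1}^k\frac{(-1)^{l+1}}{l}\binom kl$. Derivatives of distributions are distributional. Then $H_k=\sum_{j=1}^k\frac1j$ is the $k$-th harmonic number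 ($H_0=0$), and for every $\mu>0$: 1. The integral defining $\langle T_\mu f,\varphi\rangle$ converges absolutely and defines a tempered distribution $T_\mu f$, which extends $f$: $\langle T_\mu f,\varphi\rangle=\int f\varphi$, with absolute convergence, for every Schwartz function $\varphi$ that vanishes together with all its derivatives at $0$. 2. For $|\beta|=k+1$ the function $\frac{x^\beta f(x)}{\beta!}\log(\mu|x|)$ defines a regular tempered distribution (its product with every Schwartz function is absolutely integrable), and $$T_\mu f=(-1)^k(k+1)\sum_{|\beta|=k+1}\partial^\beta\Bigl[\frac{x^\beta f(x)}{\beta!}\log(\mu|x|)\Bigr]+H_k\sum_{|\alpha|=k}c^\alpha\,\delta^\alpha .$$ 3. $\mu\,\partial_\mu T_\mu f=\sum_{|\alpha|=k}c^\alpha\,\delta^\alpha$, the derivative in $\mu$ being taken in the weak sense (after pairing with each Schwartz function). 4. For all $\lambda>0$, $$T_\mu f(\lambda x)=\lambda^{-k-d}\Bigl(T_\mu f(x)+\log\lambda\sum_{|\alpha|=k}c^\alpha\,\delta^\alpha(x)\Bigr),$$ where $\langle u(\lambda\,\cdot),\varphi\rangle=\lambda^{-d}\langle u,\varphi(\lambda^{-1}\cdot)\rangle$.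 5. $\sum_{|\alpha|=k}c^\alpha\delta^\alpha$ is a homogeneous distribution of degree $-k-d$, and $T_\mu f$ is associate homogeneous of order $1$ and degree $-k-d$; that is, there are a homogeneous distribution $f_0$ of degree $-k-d$ and a function $g$ with $T_\mu f(\lambda x)=\lambda^{-k-d}\bigl(T_\mu f(x)+g(\lambda)f_0(x)\bigr)$ for all $\lambda>0$. 6. With the Euler operator $E=\sum_{i=1}^d x_i\partial_i$, $E\,T_\mu f=(-k-d)\,T_\mu f+\sum_{|\alpha|=k}c^\alpha\,\delta^\alpha$. -/

import Mathlib

open MeasureTheory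
open scoped SchwartzMap LineDeriv ContDiff

noncomputable section

namespace CausalRenorm

/-- Coordinate space `ℝ^d` with its Euclidean norm. -/
abbrev Space (d : ℕ) : Type := EuclideanSpace ℝ (Fin d)

/-- The multi-indices `α ∈ ℕ^d` with `|α| = n`. -/
def multiIndices (d n : ℕ) : Finset (Fin d → ℕ) :=
  Finset.piAntidiag Finset.univ n

/-- `α! = ∏ᵢ αᵢ!`. -/
def multiFactorial {d : ℕ} (α : Fin d → ℕ) : ℕ := ∏ i, (α i).factorial

/-- `x^α = ∏ᵢ xᵢ^αᵢ`. -/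
def monomial {d : ℕ} (α : Fin d → ℕ) (x : Space d) : ℝ := ∏ i, x i ^ α i

/-- `∂^α = ∂₀^{α₀} ⋯ ∂_{d-1}^{α_{d-1}}`, both for Schwartz functions and (in the distributional
sense) for tempered distributions. -/
def multiDeriv {d : ℕ} {V : Type*} [LineDeriv (Space d) V V] (α : Fin d → ℕ) (u : V) : V :=
  (List.finRange d).foldr
    (fun i v => (fun w : V => ∂_{(EuclideanSpace.single i (1 : ℝ) : Space d)} w)^[α i] v) u

/-- The homogeneous Taylor polynomial of degree `n` of `φ` at the origin,
`∑_{|α| = n} x^α / α! · ∂^α φ(0)`. -/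
def taylorTerm {d : ℕ} (n : ℕ) (φ : 𝓢(Space d, ℂ)) (x : Space d) : ℂ :=
  ∑ α ∈ multiIndices d n,
    ((monomial α x / (multiFactorial α : ℝ) : ℝ) : ℂ) * (multiDeriv α φ) 0

/-- The weighted Taylor subtraction
`T_w φ (x) = φ(x) - j₀^{k-1} φ (x) - w(x) ∑_{|α| = k} x^α / α! · ∂^α φ(0)`
(the jet `j₀^{k-1}` is zero for `k = 0`). -/
def taylorSubtraction {d : ℕ} (k : ℕ) (w : Space d → ℝ) (φ : 𝓢(Space d, ℂ))
    (x : Space d) : ℂ :=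
  φ x - (∑ n ∈ Finset.range k, taylorTerm n φ x) - (w x : ℂ) * taylorTerm k φ x

/-- The weight `w_μ(x) = H(μ⁻¹ - |x|)`, with `H` the Heaviside function. -/
def heavisideWeight {d : ℕ} (μ : ℝ) (x : Space d) : ℝ :=
  if 0 < μ⁻¹ - ‖x‖ then 1 else 0

/-- `T` is the tempered distribution `T_μ f`, the transpose of the subtraction with weight `w_μ`:
`⟨T_μ f, φ⟩ = ∫ f(x) (T_{w_μ} φ)(x) dx`, the integral being absolutely convergent. -/
def IsRenormalization {d : ℕ} (k : ℕ) (f : Space d → ℂ) (μ : ℝ) (T : 𝓢'(Space d, ℂ)) : Prop :=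
  ∀ φ : 𝓢(Space d, ℂ),
    Integrable (fun x => f x * taylorSubtraction k (heavisideWeight μ) φ x) ∧
    T φ = ∫ x, f x * taylorSubtraction k (heavisideWeight μ) φ x

/-- `T` is an extension of `f` to a tempered distribution: `⟨T, φ⟩ = ∫ f φ` for every Schwartz
function `φ` that vanishes together with all its derivatives at the origin. -/
def IsExtension {d : ℕ} (f : Space d → ℂ) (T : 𝓢'(Space d, ℂ)) : Prop :=
  ∀ φ : 𝓢(Space d, ℂ), (∀ α : Fin d → ℕ, (multiDeriv α φ) 0 = 0) →
    Integrable (fun x => f x * φ x) ∧ T φ = ∫ x, f x * φ x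

/-- `u` is the (regular) tempered distribution given by the function `g`. -/
def IsRegularDistribution {d : ℕ} (g : Space d → ℂ) (u : 𝓢'(Space d, ℂ)) : Prop :=
  ∀ φ : 𝓢(Space d, ℂ), Integrable (fun x => g x * φ x) ∧ u φ = ∫ x, g x * φ x

/-- `δ^α = (-1)^{|α|} ∂^α δ / α!`. -/
def deltaMulti {d : ℕ} (α : Fin d → ℕ) : 𝓢'(Space d, ℂ) :=
  ((-1 : ℂ) ^ (∑ i, α i) / (multiFactorial α : ℂ)) •
    multiDeriv α (TemperedDistribution.delta (0 : Space d))

/-- `c^α = ∫_{|x| = 1} f(x) x^α`, with respect to the surface measure of the unit sphere. -/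
def sphereMoment {d : ℕ} (f : Space d → ℂ) (α : Fin d → ℕ) : ℂ :=
  ∫ y : Metric.sphere (0 : Space d) 1, f y * (monomial α (y : Space d) : ℂ)
    ∂((volume : Measure (Space d)).toSphere)

/-- `∑_{|α| = k} c^α δ^α`. -/
def residueDistribution {d : ℕ} (k : ℕ) (f : Space d → ℂ) : 𝓢'(Space d, ℂ) :=
  ∑ α ∈ multiIndices d k, sphereMoment f α • deltaMulti α

/-- The dilated distribution `u(t ·)` for `t > 0`: `⟨u(t ·), φ⟩ = t^{-d} ⟨u, φ(t⁻¹ ·)⟩`. -/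
def dilate {d : ℕ} (t : ℝ) (ht : 0 < t) (u : 𝓢'(Space d, ℂ)) : 𝓢'(Space d, ℂ) :=
  (((t ^ d)⁻¹ : ℝ) : ℂ) •
    PointwiseConvergenceCLM.precomp ℂ
      (SchwartzMap.compCLMOfContinuousLinearEquiv ℂ
        (ContinuousLinearEquiv.smulLeft (R₁ := ℝ) (M₁ := Space d)
          (Units.mk0 t⁻¹ (inv_ne_zero ht.ne')))) u

/-- `u` is a homogeneous distribution of degree `a`. -/
def IsHomogeneousDistribution {d : ℕ} (a : ℝ) (u : 𝓢'(Space d, ℂ)) : Prop :=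
  ∀ (t : ℝ) (ht : 0 < t), dilate t ht u = ((t ^ a : ℝ) : ℂ) • u

/-- `u` is associate homogeneous of order `1` and degree `a`: there are a homogeneous distribution
`u₀` of degree `a` and a function `g` with `u(t x) = t^a (u(x) + g(t) u₀(x))` for all `t > 0`. -/
def IsAssociateHomogeneousOne {d : ℕ} (a : ℝ) (u : 𝓢'(Space d, ℂ)) : Prop :=
  ∃ u₀ : 𝓢'(Space d, ℂ), IsHomogeneousDistribution a u₀ ∧
    ∃ g : ℝ → ℂ, ∀ (t : ℝ) (ht : 0 < t), dilate t ht u = ((t ^ a : ℝ) : ℂ) • (u + g t • u₀)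

/-- The Euler operator `E u = ∑ᵢ xᵢ ∂ᵢ u`. -/
def eulerOperator {d : ℕ} (u : 𝓢'(Space d, ℂ)) : 𝓢'(Space d, ℂ) :=
  ∑ i : Fin d, TemperedDistribution.smulLeftCLM ℂ (fun x : Space d => ((x i : ℝ) : ℂ))
    (∂_{(EuclideanSpace.single i (1 : ℝ) : Space d)} u)

end CausalRenorm

end

noncomputable section

namespace CausalRenorm

open Set Filter Topology

variable {d : ℕ}

/-! Polar coordinates turn every claim into a statement about functions of one variable. Since `f`
has degree $-d-k$, the Jacobian $r^{d-1}$ gives $\int fG=\int_{|y|=1}f(y)\int_0^\infty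
r^{-k-1}G(ry)\,dr\,dy$ (`IsHomogeneousFun.integral_mul_polar`). For the subtracted test function the
inner integrand is $r^{-k-1}$ times a weighted Taylor remainder of $u(r)=\varphi(ry)$. It is bounded
near $0$ and $O(r^{-2})$ at infinity, uniformly in $y$ (`exists_norm_rayRemainder_le`), hence
absolute convergence.

Partial integration evaluates the inner integral as $\frac1{k!}\bigl(-\int_0^\infty\log(\mu
r)\,u^{(k+1)}(r)\,dr+H_k\,u^{(k)}(0)\bigr)$, which is `rayPairing`. Lowering $k+1$ to $k$ costs a
boundary term at $0$ with coefficient $1/(k+1)$ relative to $u^{(k+1)}(0)/(k+1)!$, and these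
coefficients add up to the harmonic number (`IsRaySeq.integral_rayRemainder`). The logarithm appears
only in the last step, for $k=0$.

By the multinomial theorem
$\sum_{|\beta|=n}\frac{x^\beta}{\beta!}\partial^\beta=\frac1{n!}(x\cdot\partial)^n$, where the
coefficients $x_i$ are frozen; at $x=ry$ this is $\frac{r^n}{n!}u^{(n)}(r)$. So the closed form has
the same sphere integral of `rayPairing` (`IsHomogeneousFun.closedForm_apply`), and $\sum
c^\alpha\delta^\alpha$ pairs to the sphere integral of $f(y)\,u^{(k)}(0)/k!$.

The remaining claims are identities for `rayPairing` on each ray: $\log(t\mu r)=\log t+\log(\mu r)$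
gives the dependence on $\mu$, the substitution $r\mapsto tr$ gives scaling, and one more partial
integration gives the Euler equation. -/

/-- The `i`-th coordinate vector. -/
abbrev coordVec (i : Fin d) : Space d := EuclideanSpace.single i (1 : ℝ)

/-! ### Commuting derivatives and the multinomial form of Taylor terms -/

theorem lineDerivOp_comm (v w : Space d) (φ : 𝓢(Space d, ℂ)) :
    ∂_{v} (∂_{w} φ) = ∂_{w} (∂_{v} φ) := by
  have key : ∀ (a b x : Space d), (∂_{a} (∂_{b} φ)) x = fderiv ℝ (fderiv ℝ φ) x a b :=
    fun a b x => by
      rw [SchwartzMap.lineDerivOp_apply_eq_fderiv]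
      have h : HasFDerivAt (fderiv ℝ φ) (fderiv ℝ (fderiv ℝ φ) x) x :=
        (SchwartzMap.fderivCLM ℝ (Space d) ℂ φ).hasFDerivAt x
      have h2 : HasFDerivAt (fun z => fderiv ℝ φ z b) _ x := h.clm_apply (hasFDerivAt_const b x)
      have h3 : ⇑(∂_{b} φ : 𝓢(Space d, ℂ)) = fun z => fderiv ℝ φ z b := rfl
      rw [h3, h2.fderiv]
      simp
  ext x
  rw [key, key]
  exact second_derivative_symmetric (fun y => φ.hasFDerivAt y)
    ((SchwartzMap.fderivCLM ℝ (Space d) ℂ φ).hasFDerivAt x) v w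

/-- The directional derivative as an endomorphism of the Schwartz space. -/
def derivEnd (v : Space d) : Module.End ℂ 𝓢(Space d, ℂ) :=
  (LineDeriv.lineDerivOpCLM ℂ 𝓢(Space d, ℂ) v).toLinearMap

@[simp]
theorem derivEnd_apply (v : Space d) (φ : 𝓢(Space d, ℂ)) : derivEnd v φ = ∂_{v} φ := rfl

theorem derivEnd_pow_apply (v : Space d) (n : ℕ) (φ : 𝓢(Space d, ℂ)) :
    (derivEnd v ^ n) φ = (fun w : 𝓢(Space d, ℂ) => ∂_{v} w)^[n] φ := by
  rw [Module.End.pow_apply]; rfl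

theorem commute_derivEnd (v w : Space d) : Commute (derivEnd v) (derivEnd w) := by
  ext1 φ
  exact lineDerivOp_comm v w φ

theorem multiDeriv_eq_prod (α : Fin d → ℕ) (φ : 𝓢(Space d, ℂ)) :
    multiDeriv α φ =
      ((List.finRange d).map (fun i => derivEnd (coordVec i) ^ α i)).prod φ := by
  unfold multiDeriv
  induction List.finRange d with
  | nil => rfl
  | cons i l ih => simp [ih, Module.End.mul_apply, derivEnd_pow_apply]

theorem iterate_lineDeriv_distribution_apply (v : Space d) (n : ℕ) (u : 𝓢'(Space d, ℂ))
    (φ : 𝓢(Space d, ℂ)) :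
    ((fun w : 𝓢'(Space d, ℂ) => ∂_{v} w)^[n] u) φ = (-1 : ℂ) ^ n * u ((derivEnd v ^ n) φ) := by
  induction n generalizing φ with
  | zero => simp
  | succ n ih =>
    rw [Function.iterate_succ_apply', TemperedDistribution.lineDerivOp_apply_apply, ih, pow_succ,
      pow_succ (derivEnd v), Module.End.mul_apply, derivEnd_apply]
    simp

theorem multiDeriv_distribution_apply (α : Fin d → ℕ) (u : 𝓢'(Space d, ℂ))
    (φ : 𝓢(Space d, ℂ)) :
    multiDeriv α u φ = (-1 : ℂ) ^ (∑ i, α i) * u (multiDeriv α φ) := by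
  have key : ∀ l : List (Fin d), ∀ φ : 𝓢(Space d, ℂ),
      (l.foldr (fun i v => (fun w : 𝓢'(Space d, ℂ) => ∂_{coordVec i} w)^[α i] v) u) φ =
        (-1 : ℂ) ^ (l.map α).sum *
          u ((l.map (fun i => derivEnd (coordVec i) ^ α i)).prod φ) := by
    intro l
    induction l with
    | nil => intro φ; simp
    | cons i l ih =>
      intro φ
      -- Transposition reverses the order of the derivatives; commutativity restores it.
      have hc : Commute ((l.map (fun i => derivEnd (coordVec i) ^ α i)).prod)
          (derivEnd (coordVec i) ^ α i) := by
        apply Commute.list_prod_left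
        intro x hx
        obtain ⟨j, -, rfl⟩ := List.mem_map.1 hx
        exact (commute_derivEnd _ _).pow_pow _ _
      rw [List.foldr_cons, iterate_lineDeriv_distribution_apply, ih, List.map_cons, List.sum_cons,
        List.map_cons, List.prod_cons, ← hc.eq, Module.End.mul_apply, pow_add, mul_assoc]
  rw [multiDeriv_eq_prod, Fin.sum_univ_def]
  exact key _ φ

theorem sum_smul_coordVec (x : Space d) : ∑ i, x i • coordVec i = x := by
  ext j
  simp [coordVec, Finset.sum_apply, Pi.single_apply]

theorem derivEnd_eq_sum (x : Space d) :
    derivEnd x = ∑ i, (x i : ℂ) • derivEnd (coordVec i) := by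
  ext1 φ
  conv_lhs => rw [← sum_smul_coordVec x]
  simp only [derivEnd_apply, LineDeriv.lineDerivOp_left_sum, LinearMap.sum_apply,
    LinearMap.smul_apply, LineDeriv.lineDerivOp_left_smul]
  rfl

theorem prod_map_smul_pow {A : Type*} [Ring A] [Algebra ℂ A] {ι : Type*} (l : List ι)
    (c : ι → ℂ) (a : ι → A) (α : ι → ℕ) :
    (l.map (fun i => (c i • a i) ^ α i)).prod =
      (l.map (fun i => c i ^ α i)).prod • (l.map (fun i => a i ^ α i)).prod := by
  induction l with
  | nil => simp
  | cons i l ih =>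
    rw [List.map_cons, List.prod_cons, ih, smul_pow, smul_mul_smul_comm]
    simp only [List.map_cons, List.prod_cons]

theorem mem_multiIndices {n : ℕ} {α : Fin d → ℕ} : α ∈ multiIndices d n ↔ ∑ i, α i = n := by
  simp [multiIndices]

theorem multiFactorial_ne_zero (α : Fin d → ℕ) : multiFactorial α ≠ 0 :=
  Finset.prod_ne_zero_iff.2 fun _ _ => Nat.factorial_ne_zero _

/-- Multinomial theorem for the commuting operators $x_i\partial_i$ with $x$ frozen. It trades sums
over multi-indices for one directional derivative, so that everything restricts to rays. -/
theorem derivEnd_pow_eq_sum (x : Space d) (n : ℕ) (φ : 𝓢(Space d, ℂ)) :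
    (derivEnd x ^ n) φ = (n.factorial : ℂ) •
      ∑ α ∈ multiIndices d n,
        ((monomial α x / (multiFactorial α : ℝ) : ℝ) : ℂ) • multiDeriv α φ := by
  have hc : ((Finset.univ : Finset (Fin d)) : Set (Fin d)).Pairwise
      (Function.onFun Commute fun i => (x i : ℂ) • derivEnd (coordVec i)) := fun i _ j _ _ =>
    ((commute_derivEnd _ _).smul_left _).smul_right _
  rw [derivEnd_eq_sum, Finset.sum_pow_eq_sum_piAntidiag_of_commute _ _ hc, Finset.smul_sum,
    LinearMap.sum_apply]
  refine Finset.sum_congr rfl fun α hα => ?_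
  have hn : ∑ i, α i = n := mem_multiIndices.1 hα
  have h1 : Finset.univ.noncommProd (fun i => ((x i : ℂ) • derivEnd (coordVec i)) ^ α i)
      (hc.mono' fun _ _ h ↦ h.pow_pow ..) =
      (monomial α x : ℂ) • ((List.finRange d).map (fun i => derivEnd (coordVec i) ^ α i)).prod := by
    have h2 := prod_map_smul_pow (List.finRange d) (fun i => (x i : ℂ))
      (fun i => derivEnd (coordVec i)) α
    have h3 : (monomial α x : ℂ) = ((List.finRange d).map (fun i => (x i : ℂ) ^ α i)).prod := by
      rw [← Fin.prod_univ_def]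
      simp [monomial]
    rw [h3, ← h2]
    have h4 := Finset.noncommProd_toFinset (List.finRange d)
      (fun i => ((x i : ℂ) • derivEnd (coordVec i)) ^ α i)
      (fun i _ j _ _ => (((commute_derivEnd _ _).smul_left _).smul_right _).pow_pow _ _)
      (List.nodup_finRange d)
    rw [← h4]
    exact Finset.noncommProd_congr (by simp) (fun _ _ => rfl) _
  rw [h1, multiDeriv_eq_prod]
  have hm : (Nat.multinomial Finset.univ α : ℂ) * (multiFactorial α : ℂ) = (n.factorial : ℂ) := by
    have := Nat.multinomial_spec Finset.univ α
    rw [hn] at this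
    rw [← this, multiFactorial]; push_cast; ring
  have hne : (multiFactorial α : ℂ) ≠ 0 := Nat.cast_ne_zero.2 (multiFactorial_ne_zero α)
  rw [smul_smul, ← nsmul_eq_mul, LinearMap.smul_apply, LinearMap.smul_apply,
    ← Nat.cast_smul_eq_nsmul ℂ, smul_smul, ← hm]
  congr 1
  push_cast
  field_simp

theorem sum_monomial_mul_multiDeriv (x z : Space d) (n : ℕ) (φ : 𝓢(Space d, ℂ)) :
    ∑ α ∈ multiIndices d n,
        ((monomial α x / (multiFactorial α : ℝ) : ℝ) : ℂ) * multiDeriv α φ z =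
      (n.factorial : ℂ)⁻¹ * ((derivEnd x ^ n) φ) z := by
  rw [derivEnd_pow_eq_sum, smul_apply, sum_apply, smul_eq_mul,
    inv_mul_cancel_left₀ (Nat.cast_ne_zero.2 n.factorial_ne_zero)]
  rfl

theorem taylorTerm_eq (n : ℕ) (φ : 𝓢(Space d, ℂ)) (x : Space d) :
    taylorTerm n φ x = (n.factorial : ℂ)⁻¹ * ((derivEnd x ^ n) φ) 0 :=
  sum_monomial_mul_multiDeriv x 0 n φ

theorem derivEnd_pow_apply_eq_iteratedFDeriv (x z : Space d) (n : ℕ) (φ : 𝓢(Space d, ℂ)) :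
    ((derivEnd x ^ n) φ) z = iteratedFDeriv ℝ n φ z (fun _ => x) := by
  rw [derivEnd_pow_apply, ← LineDeriv.iteratedLineDerivOp_const_eq_iter_lineDerivOp,
    SchwartzMap.iteratedLineDerivOp_eq_iteratedFDeriv]

theorem norm_derivEnd_pow_apply_le (x z : Space d) (n : ℕ) (φ : 𝓢(Space d, ℂ)) :
    ‖((derivEnd x ^ n) φ) z‖ ≤ ‖iteratedFDeriv ℝ n φ z‖ * ‖x‖ ^ n := by
  rw [derivEnd_pow_apply_eq_iteratedFDeriv]
  exact (ContinuousMultilinearMap.le_opNorm _ _).trans (by simp)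

theorem derivEnd_smul_pow_apply (r : ℝ) (x z : Space d) (n : ℕ) (φ : 𝓢(Space d, ℂ)) :
    ((derivEnd (r • x) ^ n) φ) z = (r : ℂ) ^ n * ((derivEnd x ^ n) φ) z := by
  simp only [derivEnd_pow_apply_eq_iteratedFDeriv]
  rw [ContinuousMultilinearMap.map_smul_univ (iteratedFDeriv ℝ n φ z) (fun _ => r) (fun _ => x)]
  simp

theorem taylorTerm_smul (n : ℕ) (φ : 𝓢(Space d, ℂ)) (r : ℝ) (x : Space d) :
    taylorTerm n φ (r • x) = (r : ℂ) ^ n * taylorTerm n φ x := by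
  rw [taylorTerm_eq, taylorTerm_eq, derivEnd_smul_pow_apply]; ring

/-- The `n`-th derivative of `φ` along the ray through `y`. -/
def rayDeriv (φ : 𝓢(Space d, ℂ)) (y : Space d) (n : ℕ) (r : ℝ) : ℂ :=
  ((derivEnd y ^ n) φ) (r • y)

theorem hasDerivAt_rayDeriv (φ : 𝓢(Space d, ℂ)) (y : Space d) (n : ℕ) (r : ℝ) :
    HasDerivAt (rayDeriv φ y n) (rayDeriv φ y (n + 1) r) r := by
  have h1 : HasDerivAt (fun r : ℝ => r • y) y r := by
    simpa using (hasDerivAt_id r).smul_const y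
  have h2 := (((derivEnd y ^ n) φ).hasFDerivAt (r • y)).comp_hasDerivAt r h1
  rw [rayDeriv, pow_succ', Module.End.mul_apply]
  exact h2

/-! ### The binomial formula for harmonic numbers -/

/-- Induction by Pascal's rule: the new terms contain $\binom
kl\frac1{l+1}=\frac1{k+1}\binom{k+1}{l+1}$, whose alternating sum over $l$ is $\frac1{k+1}$. -/
theorem harmonic_eq_sum_choose (k : ℕ) :
    harmonic k =
      ∑ l ∈ Finset.Icc 1 k, (-1 : ℚ) ^ (l + 1) / (l : ℚ) * (k.choose l : ℚ) := by
  have reindex : ∀ n : ℕ, ∑ l ∈ Finset.Icc 1 n, (-1 : ℚ) ^ (l + 1) / (l : ℚ) * (n.choose l : ℚ) =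
      ∑ l ∈ Finset.range n, (-1 : ℚ) ^ l / ((l : ℚ) + 1) * (n.choose (l + 1) : ℚ) := by
    intro n
    rw [Finset.range_eq_Ico]
    refine (Finset.sum_Ico_add' (fun l : ℕ =>
      (-1 : ℚ) ^ (l + 1) / (l : ℚ) * (n.choose l : ℚ)) 0 n 1).symm.trans ?_
    refine Finset.sum_congr rfl fun l _ => ?_
    push_cast; ring
  rw [reindex]
  induction k with
  | zero => simp
  | succ k ih =>
    rw [harmonic_succ, ih]
    have hsplit : ∀ l ∈ Finset.range (k + 1),
        (-1 : ℚ) ^ l / ((l : ℚ) + 1) * ((k + 1).choose (l + 1) : ℚ) =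
          (-1 : ℚ) ^ l / ((l : ℚ) + 1) * (k.choose (l + 1) : ℚ) +
          ((k : ℚ) + 1)⁻¹ * ((-1 : ℚ) ^ l * ((k + 1).choose (l + 1) : ℚ)) := by
      intro l _
      have h1 : ((k + 1).choose (l + 1) : ℚ) = k.choose l + k.choose (l + 1) := by
        rw [Nat.choose_succ_succ]; push_cast; ring
      have h2 : ((k : ℚ) + 1) * k.choose l = (k + 1).choose (l + 1) * ((l : ℚ) + 1) := by
        exact_mod_cast Nat.add_one_mul_choose_eq k l
      have h3 : (k.choose l : ℚ) / ((l : ℚ) + 1) =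
          ((k : ℚ) + 1)⁻¹ * ((k + 1).choose (l + 1) : ℚ) := by
        field_simp
        linarith
      calc (-1 : ℚ) ^ l / ((l : ℚ) + 1) * ((k + 1).choose (l + 1) : ℚ)
          = (-1 : ℚ) ^ l / ((l : ℚ) + 1) * (k.choose (l + 1) : ℚ)
            + (-1 : ℚ) ^ l * ((k.choose l : ℚ) / ((l : ℚ) + 1)) := by rw [h1]; ring
        _ = _ := by rw [h3]; ring
    -- The vanishing alternating sum of row $k+1$, with its leading term $1$ split off.
    have halt : ∑ l ∈ Finset.range (k + 1), (-1 : ℚ) ^ l * ((k + 1).choose (l + 1) : ℚ) = 1 := by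
      have h := Int.alternating_sum_range_choose (n := k + 1)
      rw [Finset.sum_range_succ'] at h
      have h' : ∑ l ∈ Finset.range (k + 1), (-1 : ℤ) ^ l * ((k + 1).choose (l + 1) : ℤ) = 1 := by
        simp only [pow_succ, mul_neg, mul_one, neg_mul, Finset.sum_neg_distrib] at h
        simp at h
        linarith
      exact_mod_cast h'
    rw [Finset.sum_congr rfl hsplit, Finset.sum_add_distrib, ← Finset.mul_sum, halt,
      Finset.sum_range_succ]
    simp

/-! ### Taylor remainders in one variable -/

/-- The Taylor polynomial at `0`, of degree less than `m`, of a function with derivatives `u`. -/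
def taylorPoly (u : ℕ → ℝ → ℂ) (m : ℕ) (r : ℝ) : ℂ :=
  ∑ n ∈ Finset.range m, (r : ℂ) ^ n / (n.factorial : ℂ) * u n 0

theorem taylorPoly_succ (u : ℕ → ℝ → ℂ) (m : ℕ) (r : ℝ) :
    taylorPoly u (m + 1) r = taylorPoly u m r + (r : ℂ) ^ m / (m.factorial : ℂ) * u m 0 :=
  Finset.sum_range_succ _ _

theorem taylorPoly_succ_zero (u : ℕ → ℝ → ℂ) (m : ℕ) : taylorPoly u (m + 1) 0 = u 0 0 := by
  simp [taylorPoly, Finset.sum_range_succ']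

theorem hasDerivAt_taylorPoly (u : ℕ → ℝ → ℂ) (m : ℕ) (r : ℝ) :
    HasDerivAt (taylorPoly u (m + 1)) (taylorPoly (fun n => u (n + 1)) m r) r := by
  have h : HasDerivAt (fun r : ℝ => ∑ n ∈ Finset.range (m + 1),
      (r : ℂ) ^ n / (n.factorial : ℂ) * u n 0)
      (∑ n ∈ Finset.range (m + 1), ((n : ℂ) * (r : ℂ) ^ (n - 1)) / (n.factorial : ℂ) * u n 0) r := by
    refine HasDerivAt.fun_sum fun n _ => ?_
    refine HasDerivAt.mul_const (HasDerivAt.div_const ?_ _) _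
    simpa using (hasDerivAt_pow n (r : ℂ)).comp_ofReal
  refine h.congr_deriv ?_
  rw [Finset.sum_range_succ', taylorPoly]
  simp only [Nat.cast_zero, zero_mul, zero_div, add_zero, Nat.add_sub_cancel]
  refine Finset.sum_congr rfl fun n _ => ?_
  have h1 : ((n : ℂ) + 1) ≠ 0 := Nat.cast_add_one_ne_zero n
  have h2 : (n.factorial : ℂ) ≠ 0 := Nat.cast_ne_zero.2 n.factorial_ne_zero
  rw [Nat.factorial_succ]
  push_cast
  field_simp

/-- The derivative of a remainder is the remainder of one order less for the shifted sequence, so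
the mean value inequality drives an induction. The sharp factor $1/m!$ is not needed. -/
theorem norm_sub_taylorPoly_le {C : ℝ} (m : ℕ) (u : ℕ → ℝ → ℂ)
    (hu : ∀ n r, HasDerivAt (u n) (u (n + 1) r) r) (hC : ∀ r, 0 ≤ r → ‖u m r‖ ≤ C) (r : ℝ)
    (hr : 0 ≤ r) : ‖u 0 r - taylorPoly u m r‖ ≤ C * r ^ m := by
  induction m generalizing u r with
  | zero => simpa [taylorPoly] using hC r hr
  | succ m ih =>
    have hC0 : 0 ≤ C := (norm_nonneg _).trans (hC 0 le_rfl)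
    have key := norm_image_sub_le_of_norm_deriv_le_segment' (a := 0) (b := r)
      (f := fun s => u 0 s - taylorPoly u (m + 1) s)
      (f' := fun s => u 1 s - taylorPoly (fun n => u (n + 1)) m s) (C := C * r ^ m)
      (fun s _ => ((hu 0 s).sub (hasDerivAt_taylorPoly u m s)).hasDerivWithinAt)
      (fun s hs => (ih (fun n => u (n + 1)) (fun n => hu (n + 1)) hC s hs.1).trans
        (by gcongr; exacts [hs.1, hs.2.le])) r ⟨hr, le_rfl⟩
    rw [taylorPoly_succ_zero, sub_self, sub_zero, sub_zero] at key
    rwa [pow_succ, ← mul_assoc]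

/-- Taylor remainder along a ray, with the term of degree `k` weighted by `H(μ⁻¹ - r)`. -/
def rayRemainder (k : ℕ) (μ : ℝ) (u : ℕ → ℝ → ℂ) (r : ℝ) : ℂ :=
  u 0 r - taylorPoly u k r -
    ((if 0 < μ⁻¹ - r then 1 else 0 : ℝ) : ℂ) * ((r : ℂ) ^ k / (k.factorial : ℂ) * u k 0)

theorem rayRemainder_of_lt {k : ℕ} {μ : ℝ} (u : ℕ → ℝ → ℂ) {r : ℝ} (h : r < μ⁻¹) :
    rayRemainder k μ u r = u 0 r - taylorPoly u (k + 1) r := by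
  simp [rayRemainder, h, taylorPoly_succ, sub_sub]

theorem rayRemainder_of_le {k : ℕ} {μ : ℝ} (u : ℕ → ℝ → ℂ) {r : ℝ} (h : μ⁻¹ ≤ r) :
    rayRemainder k μ u r = u 0 r - taylorPoly u k r := by
  simp [rayRemainder, h.not_gt]

theorem norm_sub_taylorPoly_succ_le {B : ℝ} (m : ℕ) (u : ℕ → ℝ → ℂ)
    (hu : ∀ n r, HasDerivAt (u n) (u (n + 1) r) r) (hB : ∀ r, 0 ≤ r → ‖u m r‖ ≤ B) (r : ℝ)
    (hr : 0 ≤ r) : ‖u 0 r - taylorPoly u (m + 1) r‖ ≤ 2 * B * r ^ m := by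
  have hB0 : 0 ≤ B := (norm_nonneg _).trans (hB 0 le_rfl)
  have h1 := norm_sub_taylorPoly_le m u hu hB r hr
  have h2 : ‖(r : ℂ) ^ m / (m.factorial : ℂ) * u m 0‖ ≤ B * r ^ m := by
    rw [norm_mul, norm_div, norm_pow, Complex.norm_real, Real.norm_of_nonneg hr, Complex.norm_natCast,
      mul_comm]
    refine mul_le_mul (hB 0 le_rfl) ?_ (by positivity) hB0
    exact div_le_self (by positivity) (by exact_mod_cast m.factorial_pos)
  rw [taylorPoly_succ, ← sub_sub]
  refine (norm_sub_le _ _).trans ?_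
  linarith

/-- Below $\mu^{-1}$ the full Taylor subtraction gives $O(r^{k+1})$; above it the degree-$k$ term is
switched off and $O(r^{k-1})$ remains. That $A$ does not depend on `u` makes the bound uniform over
all directions. -/
theorem exists_norm_rayRemainder_le (k : ℕ) {μ : ℝ} (hμ : 0 < μ) :
    ∃ A : ℝ, 0 ≤ A ∧ ∀ (u : ℕ → ℝ → ℂ) (B : ℝ),
      (∀ n r, HasDerivAt (u n) (u (n + 1) r) r) →
      (∀ n ≤ k + 1, ∀ r, 0 ≤ r → ‖u n r‖ * (1 + r) ≤ B) →
      ∀ r, 0 < r → ‖rayRemainder k μ u r‖ ≤ A * B * (r ^ (k + 1) * (1 + r ^ 2)⁻¹) := by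
  set a := μ⁻¹ with ha
  have ha0 : 0 < a := inv_pos.2 hμ
  obtain ⟨A, hA⟩ : ∃ A, A = (1 + a ^ 2) + 2 * (1 + (a⁻¹) ^ 2) := ⟨_, rfl⟩
  have hA1 : 1 + a ^ 2 ≤ A := by rw [hA]; exact le_add_of_nonneg_right (by positivity)
  have hA2 : 2 * (1 + (a⁻¹) ^ 2) ≤ A := by rw [hA]; exact le_add_of_nonneg_left (by positivity)
  refine ⟨A, le_trans (by positivity) hA1, fun u B hu hB r hr => ?_⟩
  have hB' : ∀ n ≤ k + 1, ∀ r, 0 ≤ r → ‖u n r‖ ≤ B := fun n hn r hr =>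
    (le_mul_of_one_le_right (norm_nonneg _) (by linarith)).trans (hB n hn r hr)
  have hB0 : 0 ≤ B := (norm_nonneg _).trans (hB' 0 (Nat.zero_le _) 0 le_rfl)
  rcases lt_or_ge r a with h | h
  · rw [rayRemainder_of_lt u h]
    refine (norm_sub_taylorPoly_le (k + 1) u hu (hB' _ le_rfl) r hr.le).trans ?_
    have h1 : 1 ≤ (1 + a ^ 2) * (1 + r ^ 2)⁻¹ := by
      rw [← div_eq_mul_inv, le_div_iff₀ (by positivity)]
      have : r ^ 2 ≤ a ^ 2 := by gcongr
      linarith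
    calc B * r ^ (k + 1) = B * r ^ (k + 1) * 1 := by ring
      _ ≤ B * r ^ (k + 1) * ((1 + a ^ 2) * (1 + r ^ 2)⁻¹) := by gcongr
      _ ≤ B * r ^ (k + 1) * (A * (1 + r ^ 2)⁻¹) := by gcongr
      _ = _ := by ring
  · rw [rayRemainder_of_le u h]
    have h0 : r * ‖u 0 r - taylorPoly u k r‖ ≤ 2 * B * r ^ k := by
      -- For $k=0$ nothing is subtracted beyond $\mu^{-1}$, and the gain of a power of $r$ must come
      -- from the decay of $u$ itself.
      cases k with
      | zero =>
        have := hB 0 (Nat.zero_le _) r hr.le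
        have h2 : r * ‖u 0 r‖ ≤ ‖u 0 r‖ * (1 + r) := by nlinarith [norm_nonneg (u 0 r)]
        simp only [taylorPoly, Finset.range_zero, Finset.sum_empty, sub_zero, pow_zero, mul_one]
        linarith
      | succ m =>
        have := norm_sub_taylorPoly_succ_le m u hu (hB' m (by omega)) r hr.le
        calc r * ‖u 0 r - taylorPoly u (m + 1) r‖ ≤ r * (2 * B * r ^ m) := by gcongr
          _ = _ := by ring
    have h1 : 1 ≤ (1 + (a⁻¹) ^ 2) * (r ^ 2 * (1 + r ^ 2)⁻¹) := by
      rw [← mul_assoc, ← div_eq_mul_inv, le_div_iff₀ (by positivity)]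
      have : 1 ≤ (a⁻¹) ^ 2 * r ^ 2 := by
        rw [← mul_pow]
        refine one_le_pow₀ ?_
        rw [inv_mul_eq_div, le_div_iff₀ ha0]; linarith
      nlinarith
    refine le_of_mul_le_mul_left ?_ hr
    calc r * ‖u 0 r - taylorPoly u k r‖ ≤ 2 * B * r ^ k := h0
      _ = 2 * B * r ^ k * 1 := by ring
      _ ≤ 2 * B * r ^ k * ((1 + (a⁻¹) ^ 2) * (r ^ 2 * (1 + r ^ 2)⁻¹)) := by gcongr
      _ = r * (2 * (1 + (a⁻¹) ^ 2) * B * (r ^ (k + 1) * (1 + r ^ 2)⁻¹)) := by ring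
      _ ≤ r * (A * B * (r ^ (k + 1) * (1 + r ^ 2)⁻¹)) := by gcongr

/-! ### Half-line integrals with a logarithmic weight -/

/-- Redefining `f` at the endpoint makes it continuous there. The antiderivatives below involve
$\log$ or $r^{-k-1}$, whose value at $0$ is only a convention, so the limit must be used instead. -/
theorem integral_Ioi_of_hasDerivAt_of_tendsto_nhdsGT {f f' : ℝ → ℂ} {a : ℝ} {l m : ℂ}
    (hderiv : ∀ x ∈ Ioi a, HasDerivAt f (f' x) x) (f'int : IntegrableOn f' (Ioi a))
    (ha : Tendsto f (𝓝[>] a) (𝓝 l)) (hf : Tendsto f atTop (𝓝 m)) :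
    ∫ x in Ioi a, f' x = m - l := by
  have h := integral_Ioi_of_hasDerivAt_of_tendsto (f := Function.update f a l) (f' := f') (a := a)
    (m := m) ?_ ?_ f'int ?_
  · simpa using h
  · rw [continuousWithinAt_update_same]
    simpa using ha
  · intro x hx
    refine (hderiv x hx).congr_of_eventuallyEq ?_
    filter_upwards [isOpen_Ioi.mem_nhds hx] with y hy
    exact Function.update_of_ne (ne_of_gt hy) _ _
  · refine hf.congr' ?_
    filter_upwards [Ioi_mem_atTop a] with y hy
    exact (Function.update_of_ne (ne_of_gt hy) _ _).symm

/-- The decay rate used to dominate integrands with a logarithmic factor. -/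
def logDecay (r : ℝ) : ℝ := (1 + |Real.log r|) * ((1 + r) ^ 3)⁻¹

theorem logDecay_nonneg {r : ℝ} (hr : 0 ≤ r) : 0 ≤ logDecay r := by
  unfold logDecay; positivity

theorem measurable_logDecay : Measurable logDecay := by
  unfold logDecay
  fun_prop

theorem integrableOn_logDecay : IntegrableOn logDecay (Ioi 0) := by
  rw [← Ioc_union_Ioi_eq_Ioi (zero_le_one (α := ℝ))]
  refine IntegrableOn.union ?_ ?_
  · have h : IntegrableOn (fun r : ℝ => 1 + |Real.log r|) (Ioc 0 1) := by
      refine Integrable.add (integrable_const _) (Integrable.abs ?_)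
      exact ((intervalIntegrable_iff_integrableOn_Ioc_of_le zero_le_one).1
        (intervalIntegral.intervalIntegrable_log'))
    refine Integrable.mono' h measurable_logDecay.aestronglyMeasurable ?_
    filter_upwards [ae_restrict_mem measurableSet_Ioc] with r hr
    rw [Real.norm_of_nonneg (logDecay_nonneg hr.1.le), logDecay]
    refine mul_le_of_le_one_right (by positivity) (inv_le_one_of_one_le₀ (one_le_pow₀ ?_))
    linarith [hr.1]
  · refine Integrable.mono' (integrable_inv_one_add_sq.integrableOn (s := Ioi 1))
      measurable_logDecay.aestronglyMeasurable ?_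
    filter_upwards [ae_restrict_mem measurableSet_Ioi] with r hr
    have hr0 : (0 : ℝ) < r := zero_lt_one.trans hr
    rw [Real.norm_of_nonneg (logDecay_nonneg hr0.le), logDecay, abs_of_nonneg (Real.log_nonneg hr.le),
      ← div_eq_mul_inv, div_le_iff₀ (by positivity), ← div_eq_inv_mul, le_div_iff₀ (by positivity)]
    have h1 : 1 + Real.log r ≤ 1 + r := by linarith [Real.log_le_self hr0.le]
    calc (1 + Real.log r) * (1 + r ^ 2) ≤ (1 + r) * (1 + r) ^ 2 := by
          gcongr; nlinarith
      _ = _ := by ring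

theorem abs_log_mul_le {μ r : ℝ} (hμ : 0 < μ) (hr : 0 < r) :
    |Real.log (μ * r)| ≤ (1 + |Real.log μ|) * (1 + |Real.log r|) := by
  rw [Real.log_mul hμ.ne' hr.ne']
  refine (abs_add_le _ _).trans ?_
  nlinarith [abs_nonneg (Real.log μ), abs_nonneg (Real.log r)]

/-- `u` lists the successive derivatives of a function decaying with them on `[0, ∞)`. -/
structure IsRaySeq (u : ℕ → ℝ → ℂ) : Prop where
  deriv : ∀ n r, HasDerivAt (u n) (u (n + 1) r) r
  decay : ∀ n, ∃ C, ∀ r, 0 ≤ r → ‖u n r‖ * (1 + r) ^ 4 ≤ C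

namespace IsRaySeq

variable {u : ℕ → ℝ → ℂ} {μ : ℝ}

theorem shift (hu : IsRaySeq u) : IsRaySeq (fun n => u (n + 1)) :=
  ⟨fun n => hu.deriv (n + 1), fun n => hu.decay (n + 1)⟩

theorem continuous (hu : IsRaySeq u) (n : ℕ) : Continuous (u n) :=
  continuous_iff_continuousAt.2 fun r => (hu.deriv n r).continuousAt

theorem exists_bound (hu : IsRaySeq u) (m : ℕ) :
    ∃ B, 0 ≤ B ∧ ∀ n ≤ m, ∀ r, 0 ≤ r → ‖u n r‖ * (1 + r) ^ 4 ≤ B := by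
  choose C hC using hu.decay
  have hC0 : ∀ n, 0 ≤ C n := fun n => le_trans (by positivity) (hC n 0 le_rfl)
  refine ⟨∑ n ∈ Finset.range (m + 1), C n, Finset.sum_nonneg fun n _ => hC0 n,
    fun n hn r hr => (hC n r hr).trans ?_⟩
  exact Finset.single_le_sum (f := C) (fun n _ => hC0 n) (Finset.mem_range.2 (by omega))

theorem exists_bound_linear (hu : IsRaySeq u) (m : ℕ) :
    ∃ B, 0 ≤ B ∧ ∀ n ≤ m, ∀ r, 0 ≤ r → ‖u n r‖ * (1 + r) ≤ B := by
  obtain ⟨B, hB0, hB⟩ := hu.exists_bound m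
  refine ⟨B, hB0, fun n hn r hr => le_trans ?_ (hB n hn r hr)⟩
  gcongr
  exact le_self_pow₀ (by linarith) (by norm_num)

/-- Of the four powers of decay, three go into `logDecay`; the fourth absorbs the extra factor $r$
that the Euler operator produces. -/
theorem exists_norm_log_mul_le (hu : IsRaySeq u) (hμ : 0 < μ) (n : ℕ) :
    ∃ C, 0 ≤ C ∧ ∀ r, 0 < r → (1 + r) * ‖(Real.log (μ * r) : ℂ) * u n r‖ ≤ C * logDecay r := by
  obtain ⟨B, hB0, hB⟩ := hu.exists_bound n
  refine ⟨(1 + |Real.log μ|) * B, by positivity, fun r hr => ?_⟩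
  have h1 := hB n le_rfl r hr.le
  rw [norm_mul, Complex.norm_real, Real.norm_eq_abs, logDecay, ← div_eq_mul_inv, ← mul_div_assoc,
    le_div_iff₀ (by positivity)]
  calc (1 + r) * (|Real.log (μ * r)| * ‖u n r‖) * (1 + r) ^ 3
      = |Real.log (μ * r)| * (‖u n r‖ * (1 + r) ^ 4) := by ring
    _ ≤ ((1 + |Real.log μ|) * (1 + |Real.log r|)) * B := by
      gcongr
      exact abs_log_mul_le hμ hr
    _ = _ := by ring

theorem measurable_log_mul (hu : IsRaySeq u) (n : ℕ) :
    Measurable (fun r : ℝ => (Real.log (μ * r) : ℂ) * u n r) := by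
  have := (hu.continuous n).measurable
  fun_prop

theorem integrableOn_log_mul (hu : IsRaySeq u) (hμ : 0 < μ) (n : ℕ) :
    IntegrableOn (fun r : ℝ => (Real.log (μ * r) : ℂ) * u n r) (Ioi 0) := by
  obtain ⟨C, hC0, hC⟩ := hu.exists_norm_log_mul_le hμ n
  refine Integrable.mono' (integrableOn_logDecay.const_mul C)
    (hu.measurable_log_mul n).aestronglyMeasurable ?_
  filter_upwards [ae_restrict_mem measurableSet_Ioi] with r (hr : 0 < r)
  exact (le_mul_of_one_le_left (norm_nonneg _) (by linarith)).trans (hC r hr)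

theorem integrableOn_log_mul_mul (hu : IsRaySeq u) (hμ : 0 < μ) (n : ℕ) :
    IntegrableOn (fun r : ℝ => (r : ℂ) * ((Real.log (μ * r) : ℂ) * u n r)) (Ioi 0) := by
  obtain ⟨C, hC0, hC⟩ := hu.exists_norm_log_mul_le hμ n
  refine Integrable.mono' (integrableOn_logDecay.const_mul C)
    (Complex.measurable_ofReal.mul (hu.measurable_log_mul n)).aestronglyMeasurable ?_
  filter_upwards [ae_restrict_mem measurableSet_Ioi] with r (hr : 0 < r)
  refine le_trans ?_ (hC r hr)
  rw [norm_mul, Complex.norm_real, Real.norm_of_nonneg hr.le]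
  gcongr
  linarith

theorem integrableOn (hu : IsRaySeq u) (n : ℕ) : IntegrableOn (u n) (Ioi 0) := by
  obtain ⟨B, hB0, hB⟩ := hu.exists_bound n
  refine Integrable.mono' (integrableOn_logDecay.const_mul B)
    (hu.continuous n).aestronglyMeasurable ?_
  filter_upwards [ae_restrict_mem measurableSet_Ioi] with r (hr : 0 < r)
  have h1 := hB n le_rfl r hr.le
  have h2 : ‖u n r‖ * (1 + r) ^ 3 ≤ B :=
    le_trans (by gcongr <;> linarith) h1
  rw [logDecay, ← mul_assoc, ← div_eq_mul_inv, le_div_iff₀ (by positivity)]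
  nlinarith [mul_nonneg hB0 (abs_nonneg (Real.log r))]

theorem tendsto_log_mul_mul_atTop (hu : IsRaySeq u) (hμ : 0 < μ) (n : ℕ) :
    Tendsto (fun r : ℝ => (r : ℂ) * ((Real.log (μ * r) : ℂ) * u n r)) atTop (𝓝 0) := by
  obtain ⟨C, hC0, hC⟩ := hu.exists_norm_log_mul_le hμ n
  have h0 : Tendsto (fun r : ℝ => C * r⁻¹) atTop (𝓝 0) := by
    simpa using tendsto_inv_atTop_zero.const_mul C
  refine squeeze_zero_norm' ?_ h0
  filter_upwards [eventually_ge_atTop 1] with r hr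
  have hr0 : (0 : ℝ) < r := zero_lt_one.trans_le hr
  have h1 : logDecay r ≤ r⁻¹ := by
    rw [logDecay, abs_of_nonneg (Real.log_nonneg hr), ← div_eq_mul_inv, div_le_iff₀ (by positivity),
      ← div_eq_inv_mul, le_div_iff₀ hr0]
    calc (1 + Real.log r) * r ≤ (1 + r) * (1 + r) := by
          gcongr
          · exact Real.log_le_self hr0.le
          · linarith
      _ = (1 + r) ^ 2 := by ring
      _ ≤ (1 + r) ^ 3 := by gcongr <;> linarith
  calc ‖(r : ℂ) * ((Real.log (μ * r) : ℂ) * u n r)‖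
      = r * ‖(Real.log (μ * r) : ℂ) * u n r‖ := by
        rw [norm_mul (r : ℂ), Complex.norm_real, Real.norm_of_nonneg hr0.le]
    _ ≤ (1 + r) * ‖(Real.log (μ * r) : ℂ) * u n r‖ := by gcongr; linarith
    _ ≤ C * logDecay r := hC r hr0
    _ ≤ C * r⁻¹ := by gcongr

theorem tendsto_log_mul_atTop (hu : IsRaySeq u) (hμ : 0 < μ) (n : ℕ) :
    Tendsto (fun r : ℝ => (Real.log (μ * r) : ℂ) * u n r) atTop (𝓝 0) := by
  refine squeeze_zero_norm' ?_ (tendsto_zero_iff_norm_tendsto_zero.1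
    (hu.tendsto_log_mul_mul_atTop hμ n))
  filter_upwards [eventually_ge_atTop 1] with r hr
  rw [norm_mul (r : ℂ), Complex.norm_real, Real.norm_of_nonneg (zero_le_one.trans hr)]
  exact le_mul_of_one_le_left (norm_nonneg _) hr

theorem tendsto_atTop (hu : IsRaySeq u) (n : ℕ) : Tendsto (u n) atTop (𝓝 0) := by
  obtain ⟨B, hB0, hB⟩ := hu.exists_bound_linear n
  have h0 : Tendsto (fun r : ℝ => B * r⁻¹) atTop (𝓝 0) := by
    simpa using tendsto_inv_atTop_zero.const_mul B
  refine squeeze_zero_norm' ?_ h0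
  filter_upwards [eventually_gt_atTop 0] with r hr
  rw [← div_eq_mul_inv, le_div_iff₀ hr]
  refine le_trans ?_ (hB n le_rfl r hr.le)
  gcongr; linarith

theorem integral_succ (hu : IsRaySeq u) (n : ℕ) : ∫ (r : ℝ) in Ioi 0, u (n + 1) r = -u n 0 := by
  rw [integral_Ioi_of_hasDerivAt_of_tendsto' (fun r _ => hu.deriv n r) (hu.integrableOn (n + 1))
    (hu.tendsto_atTop n), zero_sub]

end IsRaySeq

theorem tendsto_mul_log_mul_nhdsGT_zero {μ : ℝ} (hμ : 0 < μ) :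
    Tendsto (fun r : ℝ => r * |Real.log (μ * r)|) (𝓝[>] 0) (𝓝 0) := by
  have h1 : Tendsto (fun r : ℝ => Real.log r * r) (𝓝[>] 0) (𝓝 0) := by
    simpa using tendsto_log_mul_rpow_nhdsGT_zero (r := 1) one_pos
  have h2 : Tendsto (fun r : ℝ => r) (𝓝[>] 0) (𝓝 0) := tendsto_id.mono_left nhdsWithin_le_nhds
  have h3 : Tendsto (fun r : ℝ => |Real.log μ * r + Real.log r * r|) (𝓝[>] 0) (𝓝 0) := by
    simpa using ((h2.const_mul (Real.log μ)).add h1).abs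
  refine h3.congr' ?_
  filter_upwards [self_mem_nhdsWithin] with r (hr : 0 < r)
  rw [Real.log_mul hμ.ne' hr.ne', ← add_mul, abs_mul, abs_of_pos hr, mul_comm]

theorem hasDerivAt_log_mul {μ r : ℝ} (hμ : 0 < μ) (hr : 0 < r) :
    HasDerivAt (fun r : ℝ => (Real.log (μ * r) : ℂ)) ((r : ℂ)⁻¹) r := by
  have h : HasDerivAt (fun r : ℝ => Real.log (μ * r)) (r⁻¹) r := by
    have := (((hasDerivAt_id r).const_mul μ).log (mul_pos hμ hr).ne')
    refine this.congr_deriv ?_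
    simp only [id]
    field_simp
  simpa using h.ofReal_comp

/-! ### Partial integration along a ray -/

namespace IsRaySeq

variable {u : ℕ → ℝ → ℂ} {μ : ℝ}

/-- Integrate the derivative of $r\log(\mu r)\,u_{n+1}(r)$: both boundary values vanish, and
differentiating the logarithm leaves $\int u_{n+1}=-u_n(0)$. -/
theorem integral_mul_log_mul_succ (hu : IsRaySeq u) (hμ : 0 < μ) (n : ℕ) :
    ∫ (r : ℝ) in Ioi 0, (r : ℂ) * ((Real.log (μ * r) : ℂ) * u (n + 2) r) =
      -(∫ (r : ℝ) in Ioi 0, (Real.log (μ * r) : ℂ) * u (n + 1) r) + u n 0 := by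
  have hint1 := (hu.integrableOn (n + 1)).add (hu.integrableOn_log_mul hμ (n + 1))
  have hint := hint1.add (hu.integrableOn_log_mul_mul hμ (n + 2))
  have key := integral_Ioi_of_hasDerivAt_of_tendsto_nhdsGT (a := 0) (l := 0) (m := 0)
    (f := fun r : ℝ => (r : ℂ) * ((Real.log (μ * r) : ℂ) * u (n + 1) r))
    (f' := fun r => u (n + 1) r + (Real.log (μ * r) : ℂ) * u (n + 1) r +
      (r : ℂ) * ((Real.log (μ * r) : ℂ) * u (n + 2) r)) ?_ hint ?_
      (hu.tendsto_log_mul_mul_atTop hμ _)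
  · have e1 := integral_add hint1 (hu.integrableOn_log_mul_mul hμ (n + 2))
    have e2 := integral_add (hu.integrableOn (n + 1)) (hu.integrableOn_log_mul hμ (n + 1))
    simp only [Pi.add_apply] at e1 e2
    rw [e1, e2, hu.integral_succ] at key
    linear_combination key
  · intro r (hr : 0 < r)
    have h1 : HasDerivAt (fun r : ℝ => (r : ℂ)) 1 r := by
      simpa using (hasDerivAt_id r).ofReal_comp
    refine (h1.mul ((hasDerivAt_log_mul hμ hr).mul (hu.deriv (n + 1) r))).congr_deriv ?_
    have : (r : ℂ) ≠ 0 := Complex.ofReal_ne_zero.2 hr.ne'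
    simp only [Pi.mul_apply]
    field_simp
    ring
  · obtain ⟨B, hB0, hB⟩ := hu.exists_bound_linear (n + 1)
    refine squeeze_zero_norm' (a := fun r => B * (r * |Real.log (μ * r)|)) ?_
      (by simpa using (tendsto_mul_log_mul_nhdsGT_zero hμ).const_mul B)
    filter_upwards [self_mem_nhdsWithin] with r (hr : 0 < r)
    have := (le_mul_of_one_le_right (norm_nonneg (u (n + 1) r)) (by linarith)).trans
      (hB _ le_rfl r hr.le)
    rw [norm_mul, norm_mul, Complex.norm_real, Complex.norm_real, Real.norm_of_nonneg hr.le,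
      Real.norm_eq_abs, ← mul_assoc, mul_comm]
    gcongr

theorem measurable_rayRemainder (hu : IsRaySeq u) (k : ℕ) (μ : ℝ) :
    Measurable (rayRemainder k μ u) := by
  have := (hu.continuous 0).measurable
  have h2 : Measurable (fun r : ℝ => (if 0 < μ⁻¹ - r then 1 else 0 : ℝ)) :=
    Measurable.ite (measurableSet_lt measurable_const (by fun_prop)) measurable_const
      measurable_const
  unfold rayRemainder taylorPoly
  fun_prop

theorem integrableOn_rayRemainder (hu : IsRaySeq u) (hμ : 0 < μ) (k : ℕ) :
    IntegrableOn (fun r : ℝ => ((r : ℂ) ^ (k + 1))⁻¹ * rayRemainder k μ u r) (Ioi 0) := by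
  obtain ⟨A, hA0, hA⟩ := exists_norm_rayRemainder_le k hμ
  obtain ⟨B, hB0, hB⟩ := hu.exists_bound_linear (k + 1)
  have hm := hu.measurable_rayRemainder k μ
  refine Integrable.mono' ((integrable_inv_one_add_sq.integrableOn (s := Ioi 0)).const_mul (A * B))
    (Measurable.aestronglyMeasurable (by fun_prop)) ?_
  filter_upwards [ae_restrict_mem measurableSet_Ioi] with r (hr : 0 < r)
  rw [norm_mul, norm_inv, norm_pow, Complex.norm_real, Real.norm_of_nonneg hr.le,
    inv_mul_le_iff₀ (by positivity)]
  refine (hA u B hu.deriv hB r hr).trans (le_of_eq ?_)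
  ring

/-- The half-line is cut at $\mu^{-1}$, the jump of the weight and the zero of $\log(\mu r)$. The
antiderivatives $\log(\mu r)(u(r)-u(0))$ on the left and $\log(\mu r)\,u(r)$ on the right both
vanish at the cut and at their outer ends. -/
theorem integral_rayRemainder_zero (hu : IsRaySeq u) (hμ : 0 < μ) :
    ∫ (r : ℝ) in Ioi 0, (r : ℂ)⁻¹ * rayRemainder 0 μ u r =
      -∫ (r : ℝ) in Ioi 0, (Real.log (μ * r) : ℂ) * u 1 r := by
  have ha : 0 < μ⁻¹ := inv_pos.2 hμ
  have hint1 : IntegrableOn (fun r : ℝ => (r : ℂ)⁻¹ * rayRemainder 0 μ u r) (Ioi 0) := by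
    simpa using hu.integrableOn_rayRemainder hμ 0
  have hint2 := hu.integrableOn_log_mul hμ 1
  have hint : IntegrableOn (fun r : ℝ => (r : ℂ)⁻¹ * rayRemainder 0 μ u r +
    (Real.log (μ * r) : ℂ) * u 1 r) (Ioi 0) := hint1.add hint2
  have hlog : (Real.log (μ * μ⁻¹) : ℂ) = 0 := by simp [hμ.ne']
  have hcont : ContinuousAt (fun r : ℝ => (Real.log (μ * r) : ℂ)) μ⁻¹ :=
    (hasDerivAt_log_mul hμ ha).continuousAt
  have key1 := intervalIntegral.integral_eq_sub_of_hasDerivAt_of_tendsto ha (fa := 0) (fb := 0)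
    (f := fun r : ℝ => (Real.log (μ * r) : ℂ) * (u 0 r - u 0 0))
    (f' := fun r : ℝ => (r : ℂ)⁻¹ * rayRemainder 0 μ u r + (Real.log (μ * r) : ℂ) * u 1 r)
    ?_ ?_ ?_ ?_
  rotate_left
  · intro r hr
    refine ((hasDerivAt_log_mul hμ hr.1).mul ((hu.deriv 0 r).sub_const _)).congr_deriv ?_
    rw [rayRemainder_of_lt u hr.2]
    simp [taylorPoly]
  · exact (intervalIntegrable_iff_integrableOn_Ioc_of_le ha.le).2
      (hint.mono_set Ioc_subset_Ioi_self)
  · obtain ⟨B, hB0, hB⟩ := hu.exists_bound_linear 1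
    refine squeeze_zero_norm' (a := fun r => B * (r * |Real.log (μ * r)|)) ?_
      (by simpa using (tendsto_mul_log_mul_nhdsGT_zero hμ).const_mul B)
    filter_upwards [self_mem_nhdsWithin] with r (hr : 0 < r)
    have := norm_sub_taylorPoly_le 1 u hu.deriv (C := B)
      (fun r hr => (le_mul_of_one_le_right (norm_nonneg _) (by linarith)).trans
        (hB 1 le_rfl r hr)) r hr.le
    simp [taylorPoly] at this
    rw [norm_mul, Complex.norm_real, Real.norm_eq_abs, ← mul_assoc, mul_comm]
    gcongr
  · have h1 : ContinuousAt (fun r : ℝ => (Real.log (μ * r) : ℂ) * (u 0 r - u 0 0)) μ⁻¹ :=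
      hcont.mul ((hu.continuous 0).continuousAt.sub continuousAt_const)
    have h2 := h1.tendsto
    rw [hlog, zero_mul] at h2
    exact h2.mono_left nhdsWithin_le_nhds
  have key2 := integral_Ioi_of_hasDerivAt_of_tendsto_nhdsGT (a := μ⁻¹) (l := 0) (m := 0)
    (f := fun r : ℝ => (Real.log (μ * r) : ℂ) * u 0 r)
    (f' := fun r : ℝ => (r : ℂ)⁻¹ * rayRemainder 0 μ u r + (Real.log (μ * r) : ℂ) * u 1 r)
    ?_ (hint.mono_set (Ioi_subset_Ioi ha.le)) ?_ (hu.tendsto_log_mul_atTop hμ 0)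
  rotate_left
  · intro r (hr : μ⁻¹ < r)
    refine ((hasDerivAt_log_mul hμ (ha.trans hr)).mul (hu.deriv 0 r)).congr_deriv ?_
    rw [rayRemainder_of_le u hr.le]
    simp [taylorPoly]
  · have h1 : ContinuousAt (fun r : ℝ => (Real.log (μ * r) : ℂ) * u 0 r) μ⁻¹ :=
      hcont.mul (hu.continuous 0).continuousAt
    have h2 := h1.tendsto
    rw [hlog, zero_mul] at h2
    exact h2.mono_left nhdsWithin_le_nhds
  have hsum : ∫ (r : ℝ) in Ioi 0, ((r : ℂ)⁻¹ * rayRemainder 0 μ u r +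
      (Real.log (μ * r) : ℂ) * u 1 r) = 0 := by
    rw [← Ioc_union_Ioi_eq_Ioi ha.le, setIntegral_union (Ioc_disjoint_Ioi le_rfl) measurableSet_Ioi
      (hint.mono_set Ioc_subset_Ioi_self) (hint.mono_set (Ioi_subset_Ioi ha.le)), key2,
      ← intervalIntegral.integral_of_le ha.le, key1]
    simp
  rw [integral_add hint1 hint2] at hsum
  exact eq_neg_of_add_eq_zero_left hsum

/-- Partial integration of $r^{-k-2}$ against the remainder. The weighted top-degree terms of the
two integrands cancel identically, so the antiderivative uses the unweighted Taylor polynomial of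
degree $k$ and no cut at $\mu^{-1}$ is needed. Only the boundary term at $0$ survives. -/
theorem integral_rayRemainder_succ (hu : IsRaySeq u) (hμ : 0 < μ) (k : ℕ) :
    ∫ (r : ℝ) in Ioi 0, ((r : ℂ) ^ (k + 2))⁻¹ * rayRemainder (k + 1) μ u r =
      ((k : ℂ) + 1)⁻¹ * (∫ (r : ℝ) in Ioi 0, ((r : ℂ) ^ (k + 1))⁻¹ *
        rayRemainder k μ (fun n => u (n + 1)) r) +
      ((k : ℂ) + 1)⁻¹ * (((k + 1).factorial : ℂ)⁻¹ * u (k + 1) 0) := by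
  have hk : (k : ℂ) + 1 ≠ 0 := Nat.cast_add_one_ne_zero k
  have hint1 := hu.integrableOn_rayRemainder hμ (k + 1)
  have hint2 := (hu.shift.integrableOn_rayRemainder hμ k).const_mul (((k : ℂ) + 1)⁻¹)
  obtain ⟨B, hB0, hB⟩ := hu.exists_bound_linear (k + 2)
  have hB' : ∀ n ≤ k + 2, ∀ r, 0 ≤ r → ‖u n r‖ ≤ B := fun n hn r hr =>
    (le_mul_of_one_le_right (norm_nonneg _) (by linarith)).trans (hB n hn r hr)
  have key := integral_Ioi_of_hasDerivAt_of_tendsto_nhdsGT (a := 0)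
    (l := -(((k : ℂ) + 1)⁻¹ * (((k + 1).factorial : ℂ)⁻¹ * u (k + 1) 0))) (m := 0)
    (f := fun r : ℝ => -(((k : ℂ) + 1)⁻¹ * (((r : ℂ) ^ (k + 1))⁻¹ *
      (u 0 r - taylorPoly u (k + 1) r))))
    (f' := fun r => ((r : ℂ) ^ (k + 2))⁻¹ * rayRemainder (k + 1) μ u r -
      ((k : ℂ) + 1)⁻¹ * (((r : ℂ) ^ (k + 1))⁻¹ * rayRemainder k μ (fun n => u (n + 1)) r))
    ?_ (hint1.sub hint2) ?_ ?_
  · rw [integral_sub hint1 hint2, integral_const_mul] at key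
    linear_combination key
  · intro r (hr : 0 < r)
    have hr' : (r : ℂ) ≠ 0 := Complex.ofReal_ne_zero.2 hr.ne'
    have h1 : HasDerivAt (fun r : ℝ => ((r : ℂ) ^ (k + 1))⁻¹)
        (-(((k + 1 : ℕ) : ℂ) * (r : ℂ) ^ k) / ((r : ℂ) ^ (k + 1)) ^ 2) r :=
      ((hasDerivAt_pow (k + 1) (r : ℂ)).inv (pow_ne_zero _ hr')).comp_ofReal
    refine ((h1.mul ((hu.deriv 0 r).sub (hasDerivAt_taylorPoly u k r))).const_mul
      (((k : ℂ) + 1)⁻¹)).neg.congr_deriv ?_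
    have hf : (k.factorial : ℂ) ≠ 0 := Nat.cast_ne_zero.2 k.factorial_ne_zero
    simp only [rayRemainder, Pi.sub_apply]
    rw [Nat.factorial_succ]
    push_cast
    field_simp
    ring
  · have h0 : Tendsto (fun r : ℝ => B * r) (𝓝[>] 0) (𝓝 0) := by
      have : Tendsto (fun r : ℝ => B * r) (𝓝 0) (𝓝 (B * 0)) := by
        exact (continuous_const.mul continuous_id).tendsto 0
      rw [mul_zero] at this
      exact this.mono_left nhdsWithin_le_nhds
    have hlim : Tendsto (fun r : ℝ => ((r : ℂ) ^ (k + 1))⁻¹ * (u 0 r - taylorPoly u (k + 1) r))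
        (𝓝[>] 0) (𝓝 (((k + 1).factorial : ℂ)⁻¹ * u (k + 1) 0)) := by
      rw [tendsto_iff_norm_sub_tendsto_zero]
      refine squeeze_zero' (Eventually.of_forall fun _ => norm_nonneg _) ?_ h0
      filter_upwards [self_mem_nhdsWithin] with r (hr : 0 < r)
      have hr' : (r : ℂ) ≠ 0 := Complex.ofReal_ne_zero.2 hr.ne'
      have h1 := norm_sub_taylorPoly_le (k + 2) u hu.deriv (hB' _ le_rfl) r hr.le
      -- Subtracting the expected limit completes the Taylor polynomial by one degree, leaving an
      -- error $O(r)$.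
      have h2 : ((r : ℂ) ^ (k + 1))⁻¹ * (u 0 r - taylorPoly u (k + 1) r) -
          ((k + 1).factorial : ℂ)⁻¹ * u (k + 1) 0 =
          ((r : ℂ) ^ (k + 1))⁻¹ * (u 0 r - taylorPoly u (k + 2) r) := by
        rw [taylorPoly_succ u (k + 1)]
        field_simp
        ring
      rw [h2, norm_mul, norm_inv, norm_pow, Complex.norm_real, Real.norm_of_nonneg hr.le,
        inv_mul_le_iff₀ (by positivity)]
      refine h1.trans (le_of_eq ?_)
      ring
    exact (hlim.const_mul _).neg
  · have h0 : Tendsto (fun r : ℝ => 2 * B * r⁻¹) atTop (𝓝 0) := by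
      simpa using tendsto_inv_atTop_zero.const_mul (2 * B)
    have hlim : Tendsto (fun r : ℝ => ((r : ℂ) ^ (k + 1))⁻¹ * (u 0 r - taylorPoly u (k + 1) r))
        atTop (𝓝 0) := by
      refine squeeze_zero_norm' ?_ h0
      filter_upwards [eventually_gt_atTop 0] with r hr
      rw [norm_mul, norm_inv, norm_pow, Complex.norm_real, Real.norm_of_nonneg hr.le,
        inv_mul_le_iff₀ (by positivity)]
      refine (norm_sub_taylorPoly_succ_le k u hu.deriv (hB' k (by omega)) r hr.le).trans
        (le_of_eq ?_)
      field_simp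
      ring
    simpa using (hlim.const_mul (((k : ℂ) + 1)⁻¹)).neg

theorem integral_rayRemainder (hu : IsRaySeq u) (hμ : 0 < μ) (k : ℕ) :
    ∫ (r : ℝ) in Ioi 0, ((r : ℂ) ^ (k + 1))⁻¹ * rayRemainder k μ u r =
      (k.factorial : ℂ)⁻¹ * (-(∫ (r : ℝ) in Ioi 0, (Real.log (μ * r) : ℂ) * u (k + 1) r) +
        ((harmonic k : ℚ) : ℂ) * u k 0) := by
  induction k generalizing u with
  | zero => simpa using hu.integral_rayRemainder_zero hμ
  | succ k ih =>
    have hk : (k : ℂ) + 1 ≠ 0 := Nat.cast_add_one_ne_zero k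
    have hf : (k.factorial : ℂ) ≠ 0 := Nat.cast_ne_zero.2 k.factorial_ne_zero
    rw [hu.integral_rayRemainder_succ hμ k, ih hu.shift, harmonic_succ, Nat.factorial_succ]
    push_cast
    field_simp
    ring

end IsRaySeq

/-! ### Regular tempered distributions -/

/-- A Schwartz function is bounded by a seminorm times $(1+|x|)^{-3}$, which yields both
integrability and continuity. The power $3$ matches `logDecay`. -/
theorem exists_isRegularDistribution {g : Space d → ℂ}
    (hg : Integrable (fun x => g x * ((((1 + ‖x‖) ^ 3)⁻¹ : ℝ) : ℂ))) :
    ∃ u : 𝓢'(Space d, ℂ), IsRegularDistribution g u := by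
  have hpos : ∀ x : Space d, 0 < (1 + ‖x‖) ^ 3 := fun x => by positivity
  have hbound : ∀ (φ : 𝓢(Space d, ℂ)) (x : Space d), ‖φ x‖ ≤
      (2 ^ 3 * (Finset.Iic ((3, 0) : ℕ × ℕ)).sup (schwartzSeminormFamily ℂ (Space d) ℂ) φ) *
        ((1 + ‖x‖) ^ 3)⁻¹ := by
    intro φ x
    have h := SchwartzMap.one_add_le_sup_seminorm_apply (𝕜 := ℂ) (m := (3, 0)) (k := 3) (n := 0)
      le_rfl le_rfl φ x
    rw [norm_iteratedFDeriv_zero] at h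
    rw [← div_eq_mul_inv, le_div_iff₀ (hpos x), mul_comm]
    exact h
  have hle : ∀ (φ : 𝓢(Space d, ℂ)) (x : Space d), ‖g x * φ x‖ ≤
      (2 ^ 3 * (Finset.Iic ((3, 0) : ℕ × ℕ)).sup (schwartzSeminormFamily ℂ (Space d) ℂ) φ) *
        ‖g x * ((((1 + ‖x‖) ^ 3)⁻¹ : ℝ) : ℂ)‖ := by
    intro φ x
    rw [norm_mul, norm_mul, Complex.norm_real, Real.norm_of_nonneg (inv_nonneg.2 (hpos x).le)]
    calc ‖g x‖ * ‖φ x‖ ≤ ‖g x‖ * _ := mul_le_mul_of_nonneg_left (hbound φ x) (norm_nonneg _)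
      _ = _ := by ring
  have hmeas : AEStronglyMeasurable g := by
    have h2 : Continuous fun x : Space d => ((((1 + ‖x‖) ^ 3 : ℝ)) : ℂ) := by fun_prop
    refine (hg.aestronglyMeasurable.mul h2.aestronglyMeasurable).congr (Eventually.of_forall ?_)
    intro x
    have : (((1 + ‖x‖) ^ 3 : ℝ) : ℂ) ≠ 0 := Complex.ofReal_ne_zero.2 (hpos x).ne'
    simp only [Complex.ofReal_inv, Pi.mul_apply]
    field_simp
  have hint : ∀ φ : 𝓢(Space d, ℂ), Integrable (fun x => g x * φ x) := fun φ =>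
    Integrable.mono' (hg.norm.const_mul _) (hmeas.mul φ.continuous.aestronglyMeasurable)
      (Eventually.of_forall (hle φ))
  refine ⟨ContinuousLinearMap.toPointwiseConvergenceCLM _ _ _ _
    (SchwartzMap.mkCLMtoNormedSpace (𝕜 := ℂ) (𝕜' := ℂ) (σ := RingHom.id ℂ)
      (fun φ : 𝓢(Space d, ℂ) => ∫ x, g x * φ x) ?_ ?_ ?_), fun φ => ⟨hint φ, rfl⟩⟩
  · intro φ ψ
    rw [← integral_add (hint φ) (hint ψ)]
    simp [mul_add]
  · intro a φ
    rw [RingHom.id_apply, smul_eq_mul, ← integral_const_mul]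
    refine integral_congr_ae (Eventually.of_forall fun x => ?_)
    simp only [smul_apply, smul_eq_mul]
    ring
  · refine ⟨Finset.Iic (3, 0), 2 ^ 3 * ∫ x, ‖g x * ((((1 + ‖x‖) ^ 3)⁻¹ : ℝ) : ℂ)‖,
      by positivity, fun φ => ?_⟩
    refine (norm_integral_le_of_norm_le (hg.norm.const_mul _)
      (Eventually.of_forall (hle φ))).trans (le_of_eq ?_)
    rw [integral_const_mul]
    ring

/-! ### Homogeneous functions in polar coordinates -/

/-- Continuity away from the origin and homogeneity of degree `-d-k`. -/
structure IsHomogeneousFun (k : ℕ) (f : Space d → ℂ) : Prop where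
  continuousOn : ContinuousOn f {0}ᶜ
  map_smul : ∀ t : ℝ, 0 < t → ∀ x : Space d, x ≠ 0 → f (t • x) = ((t : ℂ) ^ (d + k))⁻¹ * f x

theorem rpow_neg_sub_eq (t : ℝ) (ht : 0 < t) (m n : ℕ) :
    ((t ^ (-(m : ℝ) - (n : ℝ)) : ℝ) : ℂ) = ((t : ℂ) ^ (m + n))⁻¹ := by
  have : -(m : ℝ) - (n : ℝ) = -((m + n : ℕ) : ℝ) := by push_cast; ring
  rw [this, Real.rpow_neg ht.le, Real.rpow_natCast]
  push_cast
  rfl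

theorem integral_polar [NeZero d] {F : Space d → ℂ} (hF : Integrable F) :
    Integrable (fun y : Metric.sphere (0 : Space d) 1 =>
      ∫ (r : ℝ) in Ioi 0, ((r : ℂ) ^ (d - 1)) * F (r • (y : Space d)))
      (volume : Measure (Space d)).toSphere ∧
    ∫ x, F x = ∫ y : Metric.sphere (0 : Space d) 1,
      (∫ (r : ℝ) in Ioi 0, ((r : ℂ) ^ (d - 1)) * F (r • (y : Space d)))
      ∂(volume : Measure (Space d)).toSphere := by
  have hmp := (volume : Measure (Space d)).measurePreserving_homeomorphUnitSphereProd
  have hemb := (homeomorphUnitSphereProd (Space d)).measurableEmbedding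
  rw [finrank_euclideanSpace_fin] at hmp
  set P : Metric.sphere (0 : Space d) 1 × Ioi (0 : ℝ) → ℂ := fun p => F (p.2.1 • p.1.1) with hP
  have hcomp : P ∘ homeomorphUnitSphereProd (Space d) = fun x : ({0}ᶜ : Set (Space d)) => F x := by
    funext x
    have h := (homeomorphUnitSphereProd (Space d)).symm_apply_apply x
    have h2 := congrArg Subtype.val h
    rw [homeomorphUnitSphereProd_symm_apply_coe] at h2
    simp only [hP, Function.comp]
    rw [h2]
  have hPint : Integrable P ((volume : Measure (Space d)).toSphere.prod
      (Measure.volumeIoiPow (d - 1))) := by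
    rw [← hmp.integrable_comp_emb hemb, hcomp]
    have h1 : IntegrableOn F {0}ᶜ := hF.integrableOn
    -- The origin is a null set because $d\ge1$, so integrals may be taken over its complement,
    -- where polar coordinates are a homeomorphism.
    rw [integrableOn_iff_comap_subtypeVal (measurableSet_singleton _).compl] at h1
    exact h1
  have hinner : ∀ y : Metric.sphere (0 : Space d) 1,
      ∫ r, P (y, r) ∂(Measure.volumeIoiPow (d - 1)) =
        ∫ (r : ℝ) in Ioi 0, ((r : ℂ) ^ (d - 1)) * F (r • (y : Space d)) := by
    intro y
    simp only [Measure.volumeIoiPow, ENNReal.ofReal]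
    rw [integral_withDensity_eq_integral_smul
        (measurable_subtype_coe.pow_const _).real_toNNReal,
      integral_subtype_comap measurableSet_Ioi
        fun a : ℝ ↦ Real.toNNReal (a ^ (d - 1)) • F (a • (y : Space d)),
      setIntegral_congr_fun measurableSet_Ioi fun x hx ↦ ?_]
    rw [NNReal.smul_def, Real.coe_toNNReal _ (pow_nonneg hx.out.le _), Complex.real_smul]
    push_cast
    rfl
  constructor
  · have := hPint.integral_prod_left
    simpa only [hinner] using this
  · calc ∫ x, F x = ∫ x : ({0}ᶜ : Set (Space d)), F (x : Space d)
            ∂((volume : Measure (Space d)).comap Subtype.val) := by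
          rw [integral_subtype_comap (measurableSet_singleton _).compl F,
            restrict_compl_singleton]
      _ = ∫ p, P p ∂((volume : Measure (Space d)).toSphere.prod
            (Measure.volumeIoiPow (d - 1))) := by
          rw [← hmp.integral_comp hemb, ← hcomp]
          rfl
      _ = _ := by
          rw [integral_prod _ hPint]
          simp only [hinner]

namespace IsHomogeneousFun

variable {k : ℕ} {f : Space d → ℂ}

theorem continuous_sphere (hf : IsHomogeneousFun k f) :
    Continuous (fun y : Metric.sphere (0 : Space d) 1 => f y) :=
  hf.continuousOn.comp_continuous continuous_subtype_val fun y =>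
    ne_zero_of_mem_unit_sphere y

theorem exists_bound (hf : IsHomogeneousFun k f) :
    ∃ M : ℝ, 0 ≤ M ∧ ∀ x : Space d, x ≠ 0 → ‖f x‖ ≤ M * (‖x‖ ^ (d + k))⁻¹ := by
  obtain ⟨C, hC⟩ := (isCompact_sphere (0 : Space d) 1).exists_bound_of_continuousOn
    (f := f) (hf.continuousOn.mono fun y hy => ne_zero_of_mem_unit_sphere ⟨y, hy⟩)
  refine ⟨max C 0, le_max_right _ _, fun x hx => ?_⟩
  have hx0 : 0 < ‖x‖ := norm_pos_iff.2 hx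
  have hy : ‖x‖⁻¹ • x ∈ Metric.sphere (0 : Space d) 1 := by
    simp [norm_smul, hx0.ne']
  have h1 : f x = ((‖x‖ : ℂ) ^ (d + k))⁻¹ * f (‖x‖⁻¹ • x) := by
    rw [← hf.map_smul ‖x‖ hx0 _ (ne_zero_of_mem_unit_sphere ⟨_, hy⟩), smul_smul,
      mul_inv_cancel₀ hx0.ne', one_smul]
  rw [h1, norm_mul, norm_inv, norm_pow, Complex.norm_real, norm_norm, mul_comm]
  gcongr
  exact (hC _ hy).trans (le_max_left _ _)

variable [NeZero d]

theorem aestronglyMeasurable (hf : IsHomogeneousFun k f) : AEStronglyMeasurable f := by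
  have h := hf.continuousOn.aestronglyMeasurable (μ := volume)
    (measurableSet_singleton (0 : Space d)).compl
  rwa [restrict_compl_singleton] at h

/-- Compactness of the sphere bounds $|f|$ by $M|x|^{-d-k}$; the radial Jacobian then leaves exactly
$M\,h(r)$ to integrate. -/
theorem integrable_mul (hf : IsHomogeneousFun k f) {G : Space d → ℂ}
    (hG : AEStronglyMeasurable G) {h : ℝ → ℝ} (hh : IntegrableOn h (Ioi 0))
    (hGh : ∀ x, x ≠ 0 → ‖G x‖ ≤ ‖x‖ ^ (k + 1) * h ‖x‖) : Integrable (fun x => f x * G x) := by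
  obtain ⟨M, hM0, hM⟩ := hf.exists_bound
  have hdom : Integrable (fun x : Space d => (fun r : ℝ => M * ((r ^ (d - 1))⁻¹ * h r)) ‖x‖) := by
    rw [integrable_fun_norm_addHaar volume (f := fun r : ℝ => M * ((r ^ (d - 1))⁻¹ * h r)),
      finrank_euclideanSpace_fin]
    refine (hh.const_mul M).congr ?_
    filter_upwards [ae_restrict_mem measurableSet_Ioi] with r (hr : 0 < r)
    have : r ^ (d - 1) ≠ 0 := pow_ne_zero _ hr.ne'
    rw [smul_eq_mul]
    field_simp
  refine Integrable.mono' hdom (hf.aestronglyMeasurable.mul hG) ?_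
  filter_upwards [compl_mem_ae_iff.2 (measure_singleton (0 : Space d))] with x hx
  have hx0 : 0 < ‖x‖ := norm_pos_iff.2 hx
  rw [norm_mul]
  have hpow : ‖x‖ ^ (d + k) = ‖x‖ ^ (d - 1) * ‖x‖ ^ (k + 1) := by
    rw [← pow_add]
    congr 1
    have := NeZero.pos d
    omega
  calc ‖f x‖ * ‖G x‖ ≤ (M * (‖x‖ ^ (d + k))⁻¹) * (‖x‖ ^ (k + 1) * h ‖x‖) :=
        mul_le_mul (hM x hx) (hGh x hx) (norm_nonneg _) (by positivity)
    _ = M * ((‖x‖ ^ (d - 1))⁻¹ * h ‖x‖) := by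
        rw [hpow]
        field_simp

theorem integral_mul_polar (hf : IsHomogeneousFun k f) {G : Space d → ℂ}
    (hG : Integrable (fun x => f x * G x)) :
    Integrable (fun y : Metric.sphere (0 : Space d) 1 =>
      f y * ∫ (r : ℝ) in Ioi 0, ((r : ℂ) ^ (k + 1))⁻¹ * G (r • (y : Space d)))
      (volume : Measure (Space d)).toSphere ∧
    ∫ x, f x * G x = ∫ y : Metric.sphere (0 : Space d) 1,
      (f y * ∫ (r : ℝ) in Ioi 0, ((r : ℂ) ^ (k + 1))⁻¹ * G (r • (y : Space d)))
      ∂(volume : Measure (Space d)).toSphere := by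
  have hinner : ∀ y : Metric.sphere (0 : Space d) 1,
      ∫ (r : ℝ) in Ioi 0, ((r : ℂ) ^ (d - 1)) * (f (r • (y : Space d)) * G (r • (y : Space d))) =
        f y * ∫ (r : ℝ) in Ioi 0, ((r : ℂ) ^ (k + 1))⁻¹ * G (r • (y : Space d)) := by
    intro y
    rw [← integral_const_mul]
    refine setIntegral_congr_fun measurableSet_Ioi fun r (hr : 0 < r) => ?_
    have hr' : (r : ℂ) ≠ 0 := Complex.ofReal_ne_zero.2 hr.ne'
    have hpow : (r : ℂ) ^ (d + k) = (r : ℂ) ^ (d - 1) * (r : ℂ) ^ (k + 1) := by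
      rw [← pow_add]
      congr 1
      have := NeZero.pos d
      omega
    rw [hf.map_smul r hr _ (ne_zero_of_mem_unit_sphere y), hpow]
    field_simp
  have h := integral_polar hG
  simpa only [hinner] using h

end IsHomogeneousFun

/-! ### Schwartz functions along rays -/

theorem isRaySeq_bound (φ : 𝓢(Space d, ℂ)) (m : ℕ) : ∃ B : ℝ, 0 ≤ B ∧
    ∀ n ≤ m, ∀ y : Space d, ‖y‖ = 1 → ∀ r, 0 ≤ r → ‖rayDeriv φ y n r‖ * (1 + r) ^ 4 ≤ B := by
  refine ⟨2 ^ 4 * (Finset.Iic ((4, m) : ℕ × ℕ)).sup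
    (fun m => SchwartzMap.seminorm ℂ m.1 m.2) φ, by positivity, fun n hn y hy r hr => ?_⟩
  have h := SchwartzMap.one_add_le_sup_seminorm_apply (𝕜 := ℂ) (m := (4, m)) (k := 4) (n := n)
    le_rfl hn φ (r • y)
  have h2 := norm_derivEnd_pow_apply_le y (r • y) n φ
  rw [norm_smul, hy, Real.norm_of_nonneg hr, mul_one] at h
  rw [hy, one_pow, mul_one] at h2
  refine le_trans ?_ h
  rw [mul_comm]
  exact mul_le_mul_of_nonneg_left h2 (by positivity)

theorem isRaySeq_rayDeriv (φ : 𝓢(Space d, ℂ)) {y : Space d} (hy : ‖y‖ = 1) :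
    IsRaySeq (rayDeriv φ y) := by
  refine ⟨hasDerivAt_rayDeriv φ y, fun n => ?_⟩
  obtain ⟨B, -, hB⟩ := isRaySeq_bound φ n
  exact ⟨B, hB n le_rfl y hy⟩

theorem exists_unit_smul {x : Space d} (hx : x ≠ 0) :
    ∃ y : Space d, ‖y‖ = 1 ∧ x = ‖x‖ • y := by
  have hx0 : ‖x‖ ≠ 0 := norm_ne_zero_iff.2 hx
  exact ⟨‖x‖⁻¹ • x, by simp [norm_smul, hx0], by rw [smul_smul, mul_inv_cancel₀ hx0, one_smul]⟩

theorem taylorTerm_smul_eq (n : ℕ) (φ : 𝓢(Space d, ℂ)) (r : ℝ) (y : Space d) :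
    taylorTerm n φ (r • y) = (r : ℂ) ^ n / (n.factorial : ℂ) * rayDeriv φ y n 0 := by
  rw [taylorTerm_smul, taylorTerm_eq, rayDeriv, zero_smul]
  ring

theorem taylorSubtraction_smul (k : ℕ) (μ : ℝ) (φ : 𝓢(Space d, ℂ)) {r : ℝ} (hr : 0 < r)
    {y : Space d} (hy : ‖y‖ = 1) :
    taylorSubtraction k (heavisideWeight μ) φ (r • y) = rayRemainder k μ (rayDeriv φ y) r := by
  simp only [taylorSubtraction, taylorTerm_smul_eq, rayRemainder, taylorPoly, heavisideWeight,
    norm_smul, hy, Real.norm_of_nonneg hr.le, mul_one]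
  simp [rayDeriv]

theorem abs_monomial_le (α : Fin d → ℕ) (x : Space d) : |monomial α x| ≤ ‖x‖ ^ (∑ i, α i) := by
  rw [monomial, Finset.abs_prod, ← Finset.prod_pow_eq_pow_sum]
  refine Finset.prod_le_prod (fun _ _ => abs_nonneg _) fun i _ => ?_
  rw [abs_pow]
  gcongr
  exact PiLp.norm_apply_le x i

theorem continuous_monomial (α : Fin d → ℕ) : Continuous (monomial α : Space d → ℝ) := by
  unfold monomial
  fun_prop

theorem continuous_taylorTerm (n : ℕ) (φ : 𝓢(Space d, ℂ)) : Continuous (taylorTerm n φ) := by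
  have := fun α => continuous_monomial (d := d) α
  unfold taylorTerm
  fun_prop

theorem measurable_taylorSubtraction (k : ℕ) (μ : ℝ) (φ : 𝓢(Space d, ℂ)) :
    Measurable (taylorSubtraction k (heavisideWeight μ) φ) := by
  have h1 : Measurable (heavisideWeight μ : Space d → ℝ) :=
    Measurable.ite (measurableSet_lt measurable_const (by fun_prop)) measurable_const
      measurable_const
  have h2 := fun n => (continuous_taylorTerm n φ).measurable
  have h3 := φ.continuous.measurable
  unfold taylorSubtraction
  fun_prop

namespace IsHomogeneousFun

variable {k : ℕ} {f : Space d → ℂ} [NeZero d]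

theorem integrable_mul_taylorSubtraction (hf : IsHomogeneousFun k f) {μ : ℝ} (hμ : 0 < μ)
    (φ : 𝓢(Space d, ℂ)) :
    Integrable (fun x => f x * taylorSubtraction k (heavisideWeight μ) φ x) := by
  obtain ⟨A, hA0, hA⟩ := exists_norm_rayRemainder_le k hμ
  obtain ⟨B, hB0, hB⟩ := isRaySeq_bound φ (k + 1)
  refine hf.integrable_mul (measurable_taylorSubtraction k μ φ).aestronglyMeasurable
    ((integrable_inv_one_add_sq.integrableOn (s := Ioi 0)).const_mul (A * B)) fun x hx => ?_
  obtain ⟨y, hy, hxy⟩ := exists_unit_smul hx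
  have hr : 0 < ‖x‖ := norm_pos_iff.2 hx
  rw [show taylorSubtraction k (heavisideWeight μ) φ x =
    rayRemainder k μ (rayDeriv φ y) ‖x‖ by
      conv_lhs => rw [hxy]
      exact taylorSubtraction_smul k μ φ hr hy]
  refine (hA (rayDeriv φ y) B (hasDerivAt_rayDeriv φ y) (fun n hn r hr => le_trans ?_
    (hB n hn y hy r hr)) ‖x‖ hr).trans (le_of_eq (by ring))
  gcongr
  exact le_self_pow₀ (by linarith) (by norm_num)

theorem exists_isRegularDistribution_log (hf : IsHomogeneousFun k f) {μ : ℝ} (hμ : 0 < μ)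
    {β : Fin d → ℕ} (hβ : β ∈ multiIndices d (k + 1)) :
    ∃ u : 𝓢'(Space d, ℂ), IsRegularDistribution
      (fun x => ((monomial β x / (multiFactorial β : ℝ) : ℝ) : ℂ)
        * f x * ((Real.log (μ * ‖x‖) : ℝ) : ℂ)) u := by
  apply exists_isRegularDistribution
  have hmon := (continuous_monomial β).measurable
  have hmeas : Measurable (fun x : Space d =>
      ((monomial β x / (multiFactorial β : ℝ) : ℝ) : ℂ) * ((Real.log (μ * ‖x‖) : ℝ) : ℂ) *
        ((((1 + ‖x‖) ^ 3)⁻¹ : ℝ) : ℂ)) := by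
    fun_prop
  refine (hf.integrable_mul (h := fun r => (1 + |Real.log μ|) * logDecay r)
    hmeas.aestronglyMeasurable (integrableOn_logDecay.const_mul _) fun x hx => ?_).congr
    (Eventually.of_forall fun x => ?_)
  · have hr : 0 < ‖x‖ := norm_pos_iff.2 hx
    rw [norm_mul, norm_mul, Complex.norm_real, Complex.norm_real, Complex.norm_real,
      Real.norm_of_nonneg (show 0 ≤ ((1 + ‖x‖) ^ 3)⁻¹ by positivity), Real.norm_eq_abs,
      Real.norm_eq_abs]
    have h1 : |monomial β x / (multiFactorial β : ℝ)| ≤ ‖x‖ ^ (k + 1) := by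
      rw [abs_div, Nat.abs_cast]
      refine (div_le_self (abs_nonneg _) ?_).trans ?_
      · exact_mod_cast Nat.one_le_iff_ne_zero.2 (multiFactorial_ne_zero β)
      · exact (abs_monomial_le β x).trans_eq (by rw [mem_multiIndices.1 hβ])
    calc _ ≤ ‖x‖ ^ (k + 1) * ((1 + |Real.log μ|) * (1 + |Real.log ‖x‖|)) * ((1 + ‖x‖) ^ 3)⁻¹ := by
          gcongr
          exact abs_log_mul_le hμ hr
      _ = _ := by rw [logDecay]; ring
  · simp only
    ring

end IsHomogeneousFun

/-! ### Pairings as integrals over the sphere -/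

theorem distribution_sum_apply {ι : Type*} (s : Finset ι) (u : ι → 𝓢'(Space d, ℂ))
    (φ : 𝓢(Space d, ℂ)) : (∑ i ∈ s, u i) φ = ∑ i ∈ s, u i φ := by
  classical
  induction s using Finset.induction_on with
  | empty => simp
  | insert i s hi ih => rw [Finset.sum_insert hi, Finset.sum_insert hi, ← ih]; rfl

theorem distribution_smul_apply (c : ℂ) (u : 𝓢'(Space d, ℂ)) (φ : 𝓢(Space d, ℂ)) :
    (c • u) φ = c * u φ := rfl

theorem distribution_add_apply (u v : 𝓢'(Space d, ℂ)) (φ : 𝓢(Space d, ℂ)) :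
    (u + v) φ = u φ + v φ := rfl

theorem deltaMulti_apply (α : Fin d → ℕ) (φ : 𝓢(Space d, ℂ)) :
    deltaMulti α φ = (multiFactorial α : ℂ)⁻¹ * multiDeriv α φ 0 := by
  have h : (-1 : ℂ) ^ (∑ i, α i) * (-1 : ℂ) ^ (∑ i, α i) = 1 := by
    rw [← mul_pow]; simp
  rw [deltaMulti, distribution_smul_apply, multiDeriv_distribution_apply,
    TemperedDistribution.delta_apply]
  linear_combination ((multiFactorial α : ℂ)⁻¹ * multiDeriv α φ 0) * h

/-- The pairing of the renormalized distribution with a function having derivatives `u` along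
a ray. -/
def rayPairing (k : ℕ) (μ : ℝ) (u : ℕ → ℝ → ℂ) : ℂ :=
  (k.factorial : ℂ)⁻¹ * (-(∫ (r : ℝ) in Ioi 0, (Real.log (μ * r) : ℂ) * u (k + 1) r) +
    ((harmonic k : ℚ) : ℂ) * u k 0)

theorem IsRaySeq.rayPairing_eq_add {u : ℕ → ℝ → ℂ} (hu : IsRaySeq u) (k : ℕ) {μ : ℝ}
    (hμ : 0 < μ) (t : ℝ) (ht : 0 < t) :
    rayPairing k (t * μ) u =
      rayPairing k μ u + (Real.log t : ℂ) * ((k.factorial : ℂ)⁻¹ * u k 0) := by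
  have h : ∫ (r : ℝ) in Ioi 0, (Real.log (t * μ * r) : ℂ) * u (k + 1) r =
      (∫ (r : ℝ) in Ioi 0, (Real.log (μ * r) : ℂ) * u (k + 1) r) - (Real.log t : ℂ) * u k 0 := by
    have e := integral_add (hu.integrableOn_log_mul hμ (k + 1))
      ((hu.integrableOn (k + 1)).const_mul (Real.log t : ℂ))
    rw [integral_const_mul, hu.integral_succ, mul_neg, ← sub_eq_add_neg] at e
    rw [← e]
    refine setIntegral_congr_fun measurableSet_Ioi fun r (hr : 0 < r) => ?_
    rw [mul_assoc, Real.log_mul ht.ne' (mul_pos hμ hr).ne']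
    push_cast
    ring
  rw [rayPairing, rayPairing, h]
  ring

theorem rayPairing_scale (k : ℕ) (μ : ℝ) {t : ℝ} (ht : 0 < t) (u v : ℕ → ℝ → ℂ)
    (hv : ∀ n r, v n r = ((t : ℂ) ^ n)⁻¹ * u n (t⁻¹ * r)) :
    rayPairing k μ v = ((t : ℂ) ^ k)⁻¹ * rayPairing k (t * μ) u := by
  have ht' : (t : ℂ) ≠ 0 := Complex.ofReal_ne_zero.2 ht.ne'
  have h : ∫ (r : ℝ) in Ioi 0, (Real.log (μ * r) : ℂ) * v (k + 1) r =
      ((t : ℂ) ^ k)⁻¹ * ∫ (r : ℝ) in Ioi 0, (Real.log (t * μ * r) : ℂ) * u (k + 1) r := by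
    have e := integral_comp_mul_left_Ioi
      (fun r : ℝ => (Real.log (t * μ * r) : ℂ) * u (k + 1) r) 0 (inv_pos.2 ht)
    rw [mul_zero, inv_inv, Complex.real_smul] at e
    calc ∫ (r : ℝ) in Ioi 0, (Real.log (μ * r) : ℂ) * v (k + 1) r
        = ∫ (r : ℝ) in Ioi 0, ((t : ℂ) ^ (k + 1))⁻¹ *
            ((Real.log (t * μ * (t⁻¹ * r)) : ℂ) * u (k + 1) (t⁻¹ * r)) := by
          refine setIntegral_congr_fun measurableSet_Ioi fun r _ => ?_
          have : t * μ * (t⁻¹ * r) = μ * r := by field_simp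
          rw [this, hv]
          ring
      _ = _ := by
          rw [integral_const_mul, e, pow_succ]
          field_simp
  rw [rayPairing, rayPairing, h, hv k 0, mul_zero]
  ring

/-- The sequence `v` is that of $ru'(r)$, the Euler operator on a ray. In the integral, $k+1$ drops
to $k$ by `integral_mul_log_mul_succ`, and its boundary term is the anomaly. -/
theorem IsRaySeq.rayPairing_euler {u : ℕ → ℝ → ℂ} (hu : IsRaySeq u) (k : ℕ) {μ : ℝ}
    (hμ : 0 < μ) (v : ℕ → ℝ → ℂ) (hv : ∀ n r, v n r = (r : ℂ) * u (n + 1) r + n * u n r) :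
    rayPairing k μ v = k * rayPairing k μ u - (k.factorial : ℂ)⁻¹ * u k 0 := by
  have h : ∫ (r : ℝ) in Ioi 0, (Real.log (μ * r) : ℂ) * v (k + 1) r =
      k * (∫ (r : ℝ) in Ioi 0, (Real.log (μ * r) : ℂ) * u (k + 1) r) + u k 0 := by
    have e := integral_add (hu.integrableOn_log_mul_mul hμ (k + 2))
      ((hu.integrableOn_log_mul hμ (k + 1)).const_mul ((k : ℂ) + 1))
    rw [integral_const_mul, hu.integral_mul_log_mul_succ hμ k] at e
    calc ∫ (r : ℝ) in Ioi 0, (Real.log (μ * r) : ℂ) * v (k + 1) r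
        = ∫ (r : ℝ) in Ioi 0, ((r : ℂ) * ((Real.log (μ * r) : ℂ) * u (k + 2) r) +
            ((k : ℂ) + 1) * ((Real.log (μ * r) : ℂ) * u (k + 1) r)) := by
          refine setIntegral_congr_fun measurableSet_Ioi fun r _ => ?_
          rw [hv]
          push_cast
          ring
      _ = _ := by rw [e]; ring
  rw [rayPairing, rayPairing, h, hv k 0]
  push_cast
  ring

theorem factorial_inv_mul_rayDeriv_zero (k : ℕ) (φ : 𝓢(Space d, ℂ)) (y : Space d) :
    (k.factorial : ℂ)⁻¹ * rayDeriv φ y k 0 = taylorTerm k φ y := by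
  rw [taylorTerm_eq, rayDeriv, zero_smul]

namespace IsHomogeneousFun

variable {k : ℕ} {f : Space d → ℂ}

theorem integrable_sphere (hf : IsHomogeneousFun k f) {g : Space d → ℂ} (hg : Continuous g) :
    Integrable (fun y : Metric.sphere (0 : Space d) 1 => f y * g y)
      (volume : Measure (Space d)).toSphere := by
  have h : Continuous (fun y : Metric.sphere (0 : Space d) 1 => f y * g y) :=
    hf.continuous_sphere.mul (hg.comp continuous_subtype_val)
  obtain ⟨C, hC⟩ := isCompact_univ.exists_bound_of_continuousOn h.continuousOn
  exact Integrable.of_bound h.aestronglyMeasurable C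
    (Eventually.of_forall fun y => hC y (mem_univ y))

theorem integrable_taylorTerm (hf : IsHomogeneousFun k f) (φ : 𝓢(Space d, ℂ)) :
    Integrable (fun y : Metric.sphere (0 : Space d) 1 =>
      f y * ((k.factorial : ℂ)⁻¹ * rayDeriv φ (y : Space d) k 0))
      (volume : Measure (Space d)).toSphere := by
  simp only [factorial_inv_mul_rayDeriv_zero]
  exact hf.integrable_sphere (continuous_taylorTerm k φ)

theorem residueDistribution_apply (hf : IsHomogeneousFun k f) (φ : 𝓢(Space d, ℂ)) :
    residueDistribution k f φ = ∫ y : Metric.sphere (0 : Space d) 1,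
      f y * ((k.factorial : ℂ)⁻¹ * rayDeriv φ (y : Space d) k 0)
      ∂(volume : Measure (Space d)).toSphere := by
  simp only [factorial_inv_mul_rayDeriv_zero, residueDistribution, distribution_sum_apply,
    distribution_smul_apply, deltaMulti_apply, taylorTerm, Finset.mul_sum]
  rw [integral_finsetSum]
  · refine Finset.sum_congr rfl fun α _ => ?_
    rw [sphereMoment, ← integral_mul_const]
    refine integral_congr_ae (Eventually.of_forall fun y => ?_)
    push_cast
    ring
  · intro α _
    have h : Continuous fun y : Space d =>
        ((monomial α y / (multiFactorial α : ℝ) : ℝ) : ℂ) * multiDeriv α φ 0 := by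
      have := continuous_monomial α
      fun_prop
    exact hf.integrable_sphere h

variable [NeZero d] {μ : ℝ}

theorem integral_taylorSubtraction (hf : IsHomogeneousFun k f) (hμ : 0 < μ)
    (φ : 𝓢(Space d, ℂ)) :
    Integrable (fun y : Metric.sphere (0 : Space d) 1 =>
      f y * rayPairing k μ (rayDeriv φ (y : Space d))) (volume : Measure (Space d)).toSphere ∧
    ∫ x, f x * taylorSubtraction k (heavisideWeight μ) φ x =
      ∫ y : Metric.sphere (0 : Space d) 1, f y * rayPairing k μ (rayDeriv φ (y : Space d))
        ∂(volume : Measure (Space d)).toSphere := by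
  have h := hf.integral_mul_polar (hf.integrable_mul_taylorSubtraction hμ φ)
  have hinner : ∀ y : Metric.sphere (0 : Space d) 1,
      ∫ (r : ℝ) in Ioi 0, ((r : ℂ) ^ (k + 1))⁻¹ *
        taylorSubtraction k (heavisideWeight μ) φ (r • (y : Space d)) =
      rayPairing k μ (rayDeriv φ (y : Space d)) := by
    intro y
    have hy : ‖(y : Space d)‖ = 1 := by simp
    rw [rayPairing, ← (isRaySeq_rayDeriv φ hy).integral_rayRemainder hμ k]
    refine setIntegral_congr_fun measurableSet_Ioi fun r hr => ?_
    rw [taylorSubtraction_smul k μ φ hr hy]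
  simpa only [hinner] using h

/-- Moving $\partial^\beta$ onto $\varphi$ gives the sign $(-1)^{k+1}$; the sum over $\beta$ becomes
$r^{k+1}u^{(k+1)}(r)/(k+1)!$, whose power cancels $r^{-k-1}$. The prefactor $(-1)^k(k+1)$ turns this
into $-\frac1{k!}$. -/
theorem closedForm_apply (hf : IsHomogeneousFun k f)
    {L : (Fin d → ℕ) → 𝓢'(Space d, ℂ)}
    (hL : ∀ β ∈ multiIndices d (k + 1), IsRegularDistribution
      (fun x => ((monomial β x / (multiFactorial β : ℝ) : ℝ) : ℂ)
        * f x * ((Real.log (μ * ‖x‖) : ℝ) : ℂ)) (L β)) (φ : 𝓢(Space d, ℂ)) :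
    (((-1 : ℂ) ^ k * ((k : ℂ) + 1)) • (∑ β ∈ multiIndices d (k + 1), multiDeriv β (L β))
      + ((harmonic k : ℚ) : ℂ) • residueDistribution k f) φ =
      ∫ y : Metric.sphere (0 : Space d) 1, f y * rayPairing k μ (rayDeriv φ (y : Space d))
        ∂(volume : Measure (Space d)).toSphere := by
  set G : Space d → ℂ := fun x => (Real.log (μ * ‖x‖) : ℂ) *
    (((k + 1).factorial : ℂ)⁻¹ * ((derivEnd x ^ (k + 1)) φ) x) with hG
  have hfG : ∀ x, f x * G x = ∑ β ∈ multiIndices d (k + 1),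
      ((monomial β x / (multiFactorial β : ℝ) : ℝ) : ℂ) * f x *
        ((Real.log (μ * ‖x‖) : ℝ) : ℂ) * multiDeriv β φ x := by
    intro x
    rw [hG]
    simp only
    rw [← sum_monomial_mul_multiDeriv, Finset.mul_sum, Finset.mul_sum]
    exact Finset.sum_congr rfl fun β _ => by ring
  have hint : Integrable (fun x => f x * G x) := by
    simp only [hfG]
    exact integrable_finsetSum _ fun β hβ => (hL β hβ (multiDeriv β φ)).1
  have hsum : (∑ β ∈ multiIndices d (k + 1), multiDeriv β (L β)) φ =
      (-1 : ℂ) ^ (k + 1) * ∫ x, f x * G x := by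
    simp only [hfG]
    rw [integral_finsetSum _ fun β hβ => (hL β hβ (multiDeriv β φ)).1, distribution_sum_apply,
      Finset.mul_sum]
    refine Finset.sum_congr rfl fun β hβ => ?_
    rw [multiDeriv_distribution_apply, mem_multiIndices.1 hβ, (hL β hβ (multiDeriv β φ)).2]
  have hinner : ∀ y : Metric.sphere (0 : Space d) 1,
      ∫ (r : ℝ) in Ioi 0, ((r : ℂ) ^ (k + 1))⁻¹ * G (r • (y : Space d)) =
      ((k + 1).factorial : ℂ)⁻¹ *
        ∫ (r : ℝ) in Ioi 0, (Real.log (μ * r) : ℂ) * rayDeriv φ (y : Space d) (k + 1) r := by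
    intro y
    have hy : ‖(y : Space d)‖ = 1 := by simp
    rw [← integral_const_mul]
    refine setIntegral_congr_fun measurableSet_Ioi fun r (hr : 0 < r) => ?_
    have hr' : (r : ℂ) ≠ 0 := Complex.ofReal_ne_zero.2 hr.ne'
    have hf' : ((k + 1).factorial : ℂ) ≠ 0 := Nat.cast_ne_zero.2 (Nat.factorial_ne_zero _)
    simp only [hG]
    rw [derivEnd_smul_pow_apply, norm_smul, hy, mul_one, Real.norm_of_nonneg hr.le, rayDeriv]
    field_simp
  obtain ⟨hI, hE⟩ := hf.integral_mul_polar hint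
  simp only [hinner] at hI hE
  rw [distribution_add_apply, distribution_smul_apply, distribution_smul_apply, hsum, hE,
    hf.residueDistribution_apply, ← integral_const_mul, ← integral_const_mul, ← integral_const_mul,
    ← integral_add ((hI.const_mul _).const_mul _) ((hf.integrable_taylorTerm φ).const_mul _)]
  refine integral_congr_ae (Eventually.of_forall fun y => ?_)
  have hk : (k : ℂ) + 1 ≠ 0 := Nat.cast_add_one_ne_zero k
  have hfac : (k.factorial : ℂ) ≠ 0 := Nat.cast_ne_zero.2 k.factorial_ne_zero
  have hsq : (-1 : ℂ) ^ k * (-1 : ℂ) ^ k = 1 := by rw [← mul_pow]; simp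
  simp only [rayPairing]
  generalize (∫ (r : ℝ) in Ioi 0, (Real.log (μ * r) : ℂ) *
    rayDeriv φ (y : Space d) (k + 1) r) = I
  have e1 : ((k : ℂ) + 1) * ((k + 1).factorial : ℂ)⁻¹ = (k.factorial : ℂ)⁻¹ := by
    rw [Nat.factorial_succ]
    push_cast
    field_simp
  rw [pow_succ]
  linear_combination (-(f y) * I * ((k : ℂ) + 1) * ((k + 1).factorial : ℂ)⁻¹) * hsq -
    f y * I * e1

end IsHomogeneousFun

/-! ### Dilations and the Euler operator -/

theorem derivEnd_pow_compCLM (g : Space d ≃L[ℝ] Space d) (y : Space d) (n : ℕ)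
    (φ : 𝓢(Space d, ℂ)) :
    (derivEnd y ^ n) (SchwartzMap.compCLMOfContinuousLinearEquiv ℂ g φ) =
      SchwartzMap.compCLMOfContinuousLinearEquiv ℂ g ((derivEnd (g y) ^ n) φ) := by
  induction n with
  | zero => simp
  | succ n ih =>
    rw [pow_succ', Module.End.mul_apply, ih, derivEnd_apply,
      SchwartzMap.lineDerivOp_compCLMOfContinuousLinearEquiv, pow_succ', Module.End.mul_apply,
      derivEnd_apply]

theorem rayDeriv_dilate {t : ℝ} (ht : 0 < t) (φ : 𝓢(Space d, ℂ)) (y : Space d) (n : ℕ) (r : ℝ) :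
    rayDeriv (SchwartzMap.compCLMOfContinuousLinearEquiv ℂ
      (ContinuousLinearEquiv.smulLeft (R₁ := ℝ) (M₁ := Space d)
        (Units.mk0 t⁻¹ (inv_ne_zero ht.ne'))) φ) y n r =
      ((t : ℂ) ^ n)⁻¹ * rayDeriv φ y n (t⁻¹ * r) := by
  have hg : ∀ x : Space d, ContinuousLinearEquiv.smulLeft (R₁ := ℝ) (M₁ := Space d)
      (Units.mk0 t⁻¹ (inv_ne_zero ht.ne')) x = t⁻¹ • x := fun x => rfl
  rw [rayDeriv, derivEnd_pow_compCLM, SchwartzMap.compCLMOfContinuousLinearEquiv_apply,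
    Function.comp_apply, hg, hg, derivEnd_smul_pow_apply, smul_smul, rayDeriv]
  push_cast
  rw [inv_pow]

theorem dilate_apply {t : ℝ} (ht : 0 < t) (u : 𝓢'(Space d, ℂ)) (φ : 𝓢(Space d, ℂ)) :
    dilate t ht u φ = ((t : ℂ) ^ d)⁻¹ * u (SchwartzMap.compCLMOfContinuousLinearEquiv ℂ
      (ContinuousLinearEquiv.smulLeft (R₁ := ℝ) (M₁ := Space d)
        (Units.mk0 t⁻¹ (inv_ne_zero ht.ne'))) φ) := by
  rw [dilate, distribution_smul_apply]
  push_cast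
  rfl

theorem hasTemperateGrowth_coord (i : Fin d) :
    Function.HasTemperateGrowth (fun x : Space d => ((x i : ℝ) : ℂ)) :=
  (Complex.ofRealCLM.comp (EuclideanSpace.proj (𝕜 := ℝ) i)).hasTemperateGrowth

/-- The Euler operator `∑ᵢ xᵢ ∂ᵢ` on Schwartz functions. -/
def eulerSchwartz (φ : 𝓢(Space d, ℂ)) : 𝓢(Space d, ℂ) :=
  ∑ i : Fin d, SchwartzMap.smulLeftCLM ℂ (fun x : Space d => ((x i : ℝ) : ℂ))
    (∂_{coordVec i} φ)

theorem eulerSchwartz_apply (φ : 𝓢(Space d, ℂ)) (x : Space d) :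
    eulerSchwartz φ x = (derivEnd x φ) x := by
  rw [derivEnd_eq_sum, LinearMap.sum_apply, eulerSchwartz, sum_apply, sum_apply]
  refine Finset.sum_congr rfl fun i _ => ?_
  rw [SchwartzMap.smulLeftCLM_apply_apply (hasTemperateGrowth_coord i)]
  rfl

theorem rayDeriv_eulerSchwartz (φ : 𝓢(Space d, ℂ)) (y : Space d) (n : ℕ) (r : ℝ) :
    rayDeriv (eulerSchwartz φ) y n r =
      (r : ℂ) * rayDeriv φ y (n + 1) r + n * rayDeriv φ y n r := by
  induction n generalizing r with
  | zero =>
    have h := derivEnd_smul_pow_apply r y (r • y) 1 φ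
    simp only [pow_one] at h
    simp only [rayDeriv, pow_zero, Module.End.one_apply, eulerSchwartz_apply, zero_add, pow_one,
      Nat.cast_zero, zero_mul, add_zero]
    exact h
  | succ n ih =>
    have h1 := hasDerivAt_rayDeriv (eulerSchwartz φ) y n r
    have hr : HasDerivAt (fun r : ℝ => (r : ℂ)) 1 r := by
      simpa using (hasDerivAt_id r).ofReal_comp
    have h2 := (hr.mul (hasDerivAt_rayDeriv φ y (n + 1) r)).add
      ((hasDerivAt_rayDeriv φ y n r).const_mul (n : ℂ))
    -- The induction hypothesis is differentiated in $r$; uniqueness of derivatives identifies the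
    -- next term.
    rw [show rayDeriv (eulerSchwartz φ) y n = _ from funext ih] at h1
    rw [h1.unique h2]
    push_cast
    ring

theorem lineDerivOp_smulLeftCLM_coord (i : Fin d) (φ : 𝓢(Space d, ℂ)) :
    ∂_{coordVec i} (SchwartzMap.smulLeftCLM ℂ (fun x : Space d => ((x i : ℝ) : ℂ)) φ) =
      φ + SchwartzMap.smulLeftCLM ℂ (fun x : Space d => ((x i : ℝ) : ℂ)) (∂_{coordVec i} φ) := by
  ext x
  rw [add_apply, SchwartzMap.smulLeftCLM_apply_apply (hasTemperateGrowth_coord i),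
    SchwartzMap.lineDerivOp_apply_eq_fderiv,
    SchwartzMap.smulLeftCLM_apply (hasTemperateGrowth_coord i)]
  have h1 : HasFDerivAt (fun x : Space d => ((x i : ℝ) : ℂ))
      (Complex.ofRealCLM.comp (EuclideanSpace.proj (𝕜 := ℝ) i)) x :=
    (Complex.ofRealCLM.comp (EuclideanSpace.proj (𝕜 := ℝ) i)).hasFDerivAt
  have h2 : HasFDerivAt (fun x : Space d => ((x i : ℝ) : ℂ) • φ x) _ x := h1.smul (φ.hasFDerivAt x)
  rw [h2.fderiv]
  simp [SchwartzMap.lineDerivOp_apply_eq_fderiv, add_comm]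

/-- The transpose of $x_i\partial_i$ is $-\partial_ix_i=-(1+x_i\partial_i)$; the $d$ ones add up. -/
theorem eulerOperator_apply (u : 𝓢'(Space d, ℂ)) (φ : 𝓢(Space d, ℂ)) :
    eulerOperator u φ = -((d : ℂ) * u φ + u (eulerSchwartz φ)) := by
  have h : ∀ i : Fin d, (TemperedDistribution.smulLeftCLM ℂ (fun x : Space d => ((x i : ℝ) : ℂ))
      (∂_{coordVec i} u)) φ = -(u φ + u (SchwartzMap.smulLeftCLM ℂ
        (fun x : Space d => ((x i : ℝ) : ℂ)) (∂_{coordVec i} φ))) := by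
    intro i
    rw [TemperedDistribution.smulLeftCLM_apply_apply, TemperedDistribution.lineDerivOp_apply_apply,
      map_neg, lineDerivOp_smulLeftCLM_coord, map_add]
  rw [eulerOperator, distribution_sum_apply, Finset.sum_congr rfl fun i _ => h i,
    Finset.sum_neg_distrib, Finset.sum_add_distrib, eulerSchwartz, map_sum]
  simp

variable {k : ℕ} {f : Space d → ℂ}

theorem IsRenormalization.isExtension {μ : ℝ} {T : 𝓢'(Space d, ℂ)}
    (h : IsRenormalization k f μ T) : IsExtension f T := by
  intro φ hφ
  have h0 : taylorSubtraction k (heavisideWeight μ) φ = φ := by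
    funext x
    simp [taylorSubtraction, taylorTerm, hφ]
  simpa only [h0] using h φ

theorem IsHomogeneousFun.isHomogeneousDistribution_residueDistribution
    (hf : IsHomogeneousFun k f) :
    IsHomogeneousDistribution (-(k : ℝ) - (d : ℝ)) (residueDistribution k f) := by
  intro t ht
  ext φ
  rw [dilate_apply, hf.residueDistribution_apply, distribution_smul_apply,
    hf.residueDistribution_apply, rpow_neg_sub_eq t ht, ← integral_const_mul, ← integral_const_mul]
  refine integral_congr_ae (Filter.Eventually.of_forall fun y => ?_)
  simp only [rayDeriv_dilate ht, mul_zero]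
  rw [pow_add]
  field_simp

end CausalRenorm

end

/-! ### The main theorem -/

theorem mainTheorem3 (d k : ℕ) (hd : 0 < d) (f : CausalRenorm.Space d → ℂ)
    (hsmooth : ContDiffOn ℝ ∞ f {0}ᶜ)
    (hhom : ∀ t : ℝ, 0 < t → ∀ x : CausalRenorm.Space d, x ≠ 0 →
      f (t • x) = ((t ^ (-(d : ℝ) - (k : ℝ)) : ℝ) : ℂ) * f x) :
    -- the two expressions of the harmonic number agree
    (harmonic k =
      ∑ l ∈ Finset.Icc 1 k, (-1 : ℚ) ^ (l + 1) / (l : ℚ) * (k.choose l : ℚ)) ∧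
    -- the distributions `T μ`
    ∃ T : ℝ → 𝓢'(CausalRenorm.Space d, ℂ),
      (∀ μ : ℝ, 0 < μ → CausalRenorm.IsRenormalization k f μ (T μ)) ∧
      (∀ μ : ℝ, 0 < μ → CausalRenorm.IsExtension f (T μ)) ∧
      -- closed form
      (∀ μ : ℝ, 0 < μ → ∃ L : (Fin d → ℕ) → 𝓢'(CausalRenorm.Space d, ℂ),
        (∀ β ∈ CausalRenorm.multiIndices d (k + 1),
          CausalRenorm.IsRegularDistribution
            (fun x => ((CausalRenorm.monomial β x / (CausalRenorm.multiFactorial β : ℝ) : ℝ) : ℂ)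
              * f x * ((Real.log (μ * ‖x‖) : ℝ) : ℂ)) (L β)) ∧
        T μ = ((-1 : ℂ) ^ k * ((k : ℂ) + 1)) •
              (∑ β ∈ CausalRenorm.multiIndices d (k + 1), CausalRenorm.multiDeriv β (L β))
            + ((harmonic k : ℚ) : ℂ) •
              (∑ α ∈ CausalRenorm.multiIndices d k,
                CausalRenorm.sphereMoment f α • CausalRenorm.deltaMulti α)) ∧
      -- dependence on `μ`
      (∀ μ : ℝ, 0 < μ → ∃ D : 𝓢'(CausalRenorm.Space d, ℂ),
        (∀ φ : 𝓢(CausalRenorm.Space d, ℂ), HasDerivAt (fun m : ℝ => T m φ) (D φ) μ) ∧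
        (μ : ℂ) • D = CausalRenorm.residueDistribution k f) ∧
      -- scaling
      (∀ μ : ℝ, 0 < μ → ∀ (t : ℝ) (ht : 0 < t),
        CausalRenorm.dilate t ht (T μ) =
          ((t ^ (-(k : ℝ) - (d : ℝ)) : ℝ) : ℂ) •
            (T μ + ((Real.log t : ℝ) : ℂ) • CausalRenorm.residueDistribution k f)) ∧
      CausalRenorm.IsHomogeneousDistribution (-(k : ℝ) - (d : ℝ))
        (CausalRenorm.residueDistribution k f) ∧
      (∀ μ : ℝ, 0 < μ →
        CausalRenorm.IsAssociateHomogeneousOne (-(k : ℝ) - (d : ℝ)) (T μ)) ∧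
      -- infinitesimal scaling
      (∀ μ : ℝ, 0 < μ →
        CausalRenorm.eulerOperator (T μ) =
          (-(k : ℂ) - (d : ℂ)) • T μ + CausalRenorm.residueDistribution k f) := by
  have : NeZero d := ⟨hd.ne'⟩
  have hf : CausalRenorm.IsHomogeneousFun k f :=
    ⟨hsmooth.continuousOn, fun t ht x hx => by
      rw [hhom t ht x hx, CausalRenorm.rpow_neg_sub_eq t ht]⟩
  refine ⟨CausalRenorm.harmonic_eq_sum_choose k, ?_⟩
  have hL : ∀ μ : ℝ, 0 < μ → ∃ L : (Fin d → ℕ) → 𝓢'(CausalRenorm.Space d, ℂ),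
      ∀ β ∈ CausalRenorm.multiIndices d (k + 1),
        CausalRenorm.IsRegularDistribution
          (fun x => ((CausalRenorm.monomial β x / (CausalRenorm.multiFactorial β : ℝ) : ℝ) : ℂ)
            * f x * ((Real.log (μ * ‖x‖) : ℝ) : ℂ)) (L β) := by
    intro μ hμ
    choose! L hL using fun β (hβ : β ∈ CausalRenorm.multiIndices d (k + 1)) =>
      hf.exists_isRegularDistribution_log hμ hβ
    exact ⟨L, hL⟩
  choose! L hL using hL
  -- Defining `T` by the closed form makes it a tempered distribution at once; the defining integral
  -- is recovered afterwards, both sides being the same sphere integral.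
  obtain ⟨T, hT⟩ : ∃ T : ℝ → 𝓢'(CausalRenorm.Space d, ℂ), ∀ μ, T μ =
      ((-1 : ℂ) ^ k * ((k : ℂ) + 1)) •
          (∑ β ∈ CausalRenorm.multiIndices d (k + 1), CausalRenorm.multiDeriv β (L μ β))
        + ((harmonic k : ℚ) : ℂ) • CausalRenorm.residueDistribution k f := ⟨_, fun _ => rfl⟩
  have hTapply : ∀ μ : ℝ, 0 < μ → ∀ φ, T μ φ = _ := fun μ hμ φ =>
    (congrArg (fun u : 𝓢'(CausalRenorm.Space d, ℂ) => u φ) (hT μ)).trans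
      (hf.closedForm_apply (hL μ hμ) φ)
  have hint := fun (μ : ℝ) (hμ : 0 < μ) φ => (hf.integral_taylorSubtraction hμ φ).1
  have hren : ∀ μ : ℝ, 0 < μ → CausalRenorm.IsRenormalization k f μ (T μ) := fun μ hμ φ =>
    ⟨hf.integrable_mul_taylorSubtraction hμ φ,
      (hTapply μ hμ φ).trans (hf.integral_taylorSubtraction hμ φ).2.symm⟩
  have hscale : ∀ μ : ℝ, 0 < μ → ∀ t : ℝ, 0 < t → ∀ φ,
      T (t * μ) φ = T μ φ + (Real.log t : ℂ) * CausalRenorm.residueDistribution k f φ := by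
    intro μ hμ t ht φ
    rw [hTapply _ (mul_pos ht hμ), hTapply μ hμ, hf.residueDistribution_apply,
      ← integral_const_mul,
      ← integral_add (hint μ hμ φ) ((hf.integrable_taylorTerm φ).const_mul _)]
    refine integral_congr_ae (Filter.Eventually.of_forall fun y => ?_)
    simp only
    rw [(CausalRenorm.isRaySeq_rayDeriv φ (norm_eq_of_mem_sphere y)).rayPairing_eq_add k hμ t ht]
    ring
  have hdil : ∀ μ : ℝ, 0 < μ → ∀ (t : ℝ) (ht : 0 < t),
      CausalRenorm.dilate t ht (T μ) =
        ((t ^ (-(k : ℝ) - (d : ℝ)) : ℝ) : ℂ) •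
          (T μ + ((Real.log t : ℝ) : ℂ) • CausalRenorm.residueDistribution k f) := by
    intro μ hμ t ht
    ext φ
    rw [CausalRenorm.dilate_apply, CausalRenorm.distribution_smul_apply,
      CausalRenorm.distribution_add_apply, CausalRenorm.distribution_smul_apply,
      ← hscale μ hμ t ht, hTapply μ hμ, hTapply _ (mul_pos ht hμ),
      CausalRenorm.rpow_neg_sub_eq t ht, ← integral_const_mul, ← integral_const_mul]
    refine integral_congr_ae (Filter.Eventually.of_forall fun y => ?_)
    simp only
    rw [CausalRenorm.rayPairing_scale k μ ht _ _ (CausalRenorm.rayDeriv_dilate ht φ y), pow_add]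
    field_simp
  refine ⟨T, hren, fun μ hμ => (hren μ hμ).isExtension, fun μ hμ => ⟨L μ, hL μ hμ, hT μ⟩, ?_,
    hdil, hf.isHomogeneousDistribution_residueDistribution, fun μ hμ =>
    ⟨_, hf.isHomogeneousDistribution_residueDistribution, _, hdil μ hμ⟩, ?_⟩
  · intro μ hμ
    have hμ' : (μ : ℂ) ≠ 0 := Complex.ofReal_ne_zero.2 hμ.ne'
    refine ⟨(μ : ℂ)⁻¹ • CausalRenorm.residueDistribution k f, fun φ => ?_,
      by rw [smul_smul, mul_inv_cancel₀ hμ', one_smul]⟩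
    have h1 : HasDerivAt (fun m : ℝ => T 1 φ +
        (Real.log m : ℂ) * CausalRenorm.residueDistribution k f φ)
        ((μ : ℂ)⁻¹ * CausalRenorm.residueDistribution k f φ) μ := by
      have h2 := (Real.hasDerivAt_log hμ.ne').ofReal_comp
      rw [Complex.ofReal_inv] at h2
      exact (h2.mul_const _).const_add _
    -- Taking scale $1$ as reference, $T_m=T_1+\log m\cdot\sum c^\alpha\delta^\alpha$ for all $m>0$.
    refine h1.congr_of_eventuallyEq ?_
    filter_upwards [isOpen_Ioi.mem_nhds hμ] with m hm
    rw [← hscale 1 one_pos m hm, mul_one]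
  · intro μ hμ
    ext φ
    have hE : T μ (CausalRenorm.eulerSchwartz φ) =
        k * T μ φ - CausalRenorm.residueDistribution k f φ := by
      rw [hTapply μ hμ, hTapply μ hμ, hf.residueDistribution_apply, ← integral_const_mul,
        ← integral_sub ((hint μ hμ φ).const_mul _) (hf.integrable_taylorTerm φ)]
      refine integral_congr_ae (Filter.Eventually.of_forall fun y => ?_)
      simp only
      rw [(CausalRenorm.isRaySeq_rayDeriv φ (norm_eq_of_mem_sphere y)).rayPairing_euler k hμ _
        (CausalRenorm.rayDeriv_eulerSchwartz φ y)]
      ring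
    rw [CausalRenorm.eulerOperator_apply, hE, CausalRenorm.distribution_add_apply,
      CausalRenorm.distribution_smul_apply]
    ring
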